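/- Let $n\ge 2$, $1\le k\le n-1$, and let $\mathbb{R}^n_+=\{x\in\mathbb{R}^n : x_1>0\}$, $|X_m|^2=x_1^2+\dots+x_m^2$. Denote by $C_0^\infty(\mathbb{R}^n_+)$ the real-valued smooth functions whose support is a compact subset of the open half-space $\mathbb{R}^n_+$. Let $\alpha_1,\dots,\alpha_k\le 0$ be real numbers and put $$\beta_1=-\alpha_1^2+\tfrac14,\qquad \beta_m=-\alpha_m^2+\left(\alpha_{m-1}-\tfrac12\right)^2,\quad m=2,\dots,k.$$ (i) If $\beta_{k+1}$ is a real constant such that $$\int_{\mathbb{R}^n_+}|\nabla u|^2\,dx\;\ge\;\int_{\mathbb{R}^n_+}\left(\frac{\beta_1}{|X_1|^2}+\frac{\beta_2}{|X_2|^2}+\dots+\frac{\beta_{k+1}}{|X_{k+1}|^2}\right)u^2\,dx\qquad\text{for all }u\in C_0^\infty(\mathbb{R}^n_+),$$ then $\beta_{k+1}\le\left(\alpha_k-\tfrac12\right)^2$. (ii) Moreover, $$\inf_{0\ne u\in C_0^\infty(\mathbb{R}^n_+)}\frac{\displaystyle\int_{\mathbb{R}^n_+}|\nabla u|^2dx-\beta_1\int_{\mathbb{R}^n_+}\frac{u^2}{|X_1|^2}dx-\dots-\beta_k\int_{\mathbb{R}^n_+}\frac{u^2}{|X_k|^2}dx}{\displaystyle\int_{\mathbb{R}^n_+}\frac{u^2}{|X_{k+1}|^2}dx}=\left(\alpha_k-\tfrac12\right)^2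 .$$ -/

import Mathlib

open MeasureTheory
open scoped Distributions Gradient

noncomputable section

/-- The open upper half-space `{x ∈ ℝⁿ : x₁ > 0}`; the coordinate `x₁` is `x 0`. -/
def upperHalfSpace (n : ℕ) [NeZero n] : TopologicalSpace.Opens (EuclideanSpace ℝ (Fin n)) where
  carrier := {x | 0 < x 0}
  is_open' := isOpen_lt continuous_const (by fun_prop)

/-- `|X_m|² = x₁² + ⋯ + x_m²`, the sum of the squares of the first `m` coordinates of `x`. -/
def partialNormSq {n : ℕ} (m : ℕ) (x : EuclideanSpace ℝ (Fin n)) : ℝ :=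
  ∑ i : Fin n with i.val < m, x i ^ 2

/-- The Dirichlet integral `∫ |∇u|² dx` over the half-space. -/
def dirichletIntegral {n : ℕ} [NeZero n] (u : EuclideanSpace ℝ (Fin n) → ℝ) : ℝ :=
  ∫ x in (upperHalfSpace n : Set (EuclideanSpace ℝ (Fin n))), ‖∇ u x‖ ^ 2

/-- The Hardy integral `∫ u² / |X_m|² dx` over the half-space. -/
def hardyIntegral {n : ℕ} [NeZero n] (m : ℕ) (u : EuclideanSpace ℝ (Fin n) → ℝ) : ℝ :=
  ∫ x in (upperHalfSpace n : Set (EuclideanSpace ℝ (Fin n))), u x ^ 2 / partialNormSq m x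

/-- The Rayleigh quotient
`(∫ |∇u|² - β₁ ∫ u²/|X₁|² - ⋯ - β_k ∫ u²/|X_k|²) / ∫ u²/|X_{k+1}|²`. -/
def hardyQuotient {n : ℕ} [NeZero n] (k : ℕ) (β : ℕ → ℝ)
    (u : EuclideanSpace ℝ (Fin n) → ℝ) : ℝ :=
  (dirichletIntegral u - ∑ m ∈ Finset.Icc 1 k, β m * hardyIntegral m u) / hardyIntegral (k + 1) u

end

open Set Filter Topology Real ENNReal

/-! Set `A 0 = 1`, `A j = α j` for `1 ≤ j ≤ k` and `A (k + 1) = 0`; then every constant, including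
the claimed optimal one, has the form `-A_j² + (A_{j-1} - 1/2)²`. With `γ_j = A_j - A_{j-1} + 1/2`,
let `φ = ∏ |X_j|^(-γ_j)` over `j ≤ k + 1` and `F = ∇φ / φ`. Expanding `∫ |∇u - uF|²` and integrating
the cross term by parts gives exactly the Hardy energy with these constants
(`dirichletIntegral_sub_sum_hardyIntegral`). Its nonnegativity is the lower bound for the quotient.

For sharpness, `u = φ v` turns the defect into `∫ φ² |∇v|²`, which has to be made small against `∫
φ² v² / |X_{k+1}|²`. The key fact is scaling: for each `m`, with `φ_m` the product over `j ≤ m`, the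
measure `φ_m² |X_m|^(2 A_m - 2) dx`, cut off in the remaining coordinates, is invariant under
dilations of the first `m` coordinates. Its image under `log |X_m|²` is therefore a multiple of
Lebesgue measure (`exists_lintegral_radialDensity_eq`); the signs `A_j ≤ 0` make it locally finite.
Since `A_{k+1} = 0`, a bump of width `k'` in the variable `log |X_{k+1}|²` has mass of order `k'`
and bounded energy (`exists_isTrial_weightedEnergy_lt`).

Such a `v` only avoids `X_{k+1} = 0`, whereas a test function must avoid `x₁ = 0`. Logarithmic
cutoffs near `X_m = 0` for `m = k, …, 1` repair this at arbitrarily small cost, again because `A_m ≤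
0` (`IsTrial.exists_cutoff`). -/

/-- The orthogonal projection `x ↦ X_m` onto the span of the first `m` coordinate vectors. -/
noncomputable def coordProj {n : ℕ} (m : ℕ) :
    EuclideanSpace ℝ (Fin n) →L[ℝ] EuclideanSpace ℝ (Fin n) :=
  LinearMap.toContinuousLinearMap
    { toFun := fun x => WithLp.toLp 2 fun i => if i.val < m then x i else 0
      map_add' := fun x y => by ext i; by_cases h : i.val < m <;> simp [h]
      map_smul' := fun c x => by ext i; by_cases h : i.val < m <;> simp [h] }

/-! ### Partial norms and their gradients -/

section PartialNorm

variable {n : ℕ}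

@[simp] lemma coordProj_apply (m : ℕ) (x : EuclideanSpace ℝ (Fin n)) (i : Fin n) :
    coordProj m x i = if i.val < m then x i else 0 := rfl

lemma partialNormSq_eq_sum_ite (m : ℕ) (x : EuclideanSpace ℝ (Fin n)) :
    partialNormSq m x = ∑ i : Fin n, if i.val < m then x i ^ 2 else 0 := by
  simp [partialNormSq, Finset.sum_filter]

lemma inner_coordProj (j : ℕ) (x y : EuclideanSpace ℝ (Fin n)) :
    inner ℝ x (coordProj j y) = ∑ i : Fin n, if i.val < j then x i * y i else 0 := by
  simp only [PiLp.inner_apply, coordProj_apply]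
  refine Finset.sum_congr rfl fun i _ => ?_
  split_ifs <;> simp [mul_comm]

/-- The projections are nested, so the inner product sees only the smaller one. This is what makes
`|F|²` a combination of the `|X_j|⁻²` with no mixed terms. -/
lemma inner_coordProj_coordProj {j l : ℕ} (h : j ≤ l) (x : EuclideanSpace ℝ (Fin n)) :
    inner ℝ (coordProj j x) (coordProj l x) = partialNormSq j x := by
  rw [inner_coordProj, partialNormSq_eq_sum_ite]
  refine Finset.sum_congr rfl fun i _ => ?_
  by_cases hi : i.val < j
  · simp [hi, hi.trans_le h, sq]
  · simp [hi]

lemma norm_sq_coordProj (j : ℕ) (x : EuclideanSpace ℝ (Fin n)) :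
    ‖coordProj j x‖ ^ 2 = partialNormSq j x := by
  rw [← real_inner_self_eq_norm_sq, inner_coordProj_coordProj le_rfl]

lemma partialNormSq_nonneg (m : ℕ) (x : EuclideanSpace ℝ (Fin n)) : 0 ≤ partialNormSq m x :=
  Finset.sum_nonneg fun _ _ => sq_nonneg _

lemma partialNormSq_mono {m l : ℕ} (h : m ≤ l) (x : EuclideanSpace ℝ (Fin n)) :
    partialNormSq m x ≤ partialNormSq l x := by
  rw [partialNormSq_eq_sum_ite, partialNormSq_eq_sum_ite]
  refine Finset.sum_le_sum fun i _ => ?_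
  by_cases hi : i.val < m
  · simp [hi, hi.trans_le h]
  · simp only [hi, if_false]; split_ifs <;> positivity

lemma sq_apply_le_partialNormSq {m : ℕ} {i : Fin n} (h : i.val < m)
    (x : EuclideanSpace ℝ (Fin n)) : x i ^ 2 ≤ partialNormSq m x :=
  Finset.single_le_sum (f := fun i => x i ^ 2) (fun _ _ => sq_nonneg _)
    (Finset.mem_filter.2 ⟨Finset.mem_univ _, h⟩)

lemma partialNormSq_one [NeZero n] (x : EuclideanSpace ℝ (Fin n)) :
    partialNormSq 1 x = x 0 ^ 2 := by
  rw [partialNormSq_eq_sum_ite, Finset.sum_eq_single 0]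
  · simp
  · intro i _ hi
    have : i.val ≠ 0 := fun h => hi (Fin.ext (by simpa using h))
    simp [this]
  · simp

lemma mem_upperHalfSpace [NeZero n] {x : EuclideanSpace ℝ (Fin n)} :
    x ∈ (upperHalfSpace n : Set (EuclideanSpace ℝ (Fin n))) ↔ 0 < x 0 := Iff.rfl

lemma partialNormSq_pos [NeZero n] {m : ℕ} (hm : 1 ≤ m) {x : EuclideanSpace ℝ (Fin n)}
    (hx : x ∈ (upperHalfSpace n : Set (EuclideanSpace ℝ (Fin n)))) : 0 < partialNormSq m x := by
  have h : 0 < x 0 ^ 2 := pow_pos hx 2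
  rw [← partialNormSq_one] at h
  exact h.trans_le (partialNormSq_mono hm x)

lemma contDiff_partialNormSq (m : ℕ) {k : WithTop ℕ∞} :
    ContDiff ℝ k (partialNormSq m : EuclideanSpace ℝ (Fin n) → ℝ) := by
  unfold partialNormSq
  fun_prop

@[fun_prop]
lemma continuous_partialNormSq (m : ℕ) :
    Continuous (partialNormSq m : EuclideanSpace ℝ (Fin n) → ℝ) :=
  (contDiff_partialNormSq m (k := 0)).continuous

@[fun_prop]
lemma measurable_partialNormSq (m : ℕ) :
    Measurable (partialNormSq m : EuclideanSpace ℝ (Fin n) → ℝ) :=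
  (continuous_partialNormSq m).measurable

lemma hasGradientAt_partialNormSq (m : ℕ) (x : EuclideanSpace ℝ (Fin n)) :
    HasGradientAt (partialNormSq m) ((2 : ℝ) • coordProj m x) x := by
  have h : (partialNormSq m : EuclideanSpace ℝ (Fin n) → ℝ) = fun x => ‖coordProj m x‖ ^ 2 := by
    ext y; rw [norm_sq_coordProj]
  rw [h, hasGradientAt_iff_hasFDerivAt]
  have h1 := (coordProj m : EuclideanSpace ℝ (Fin n) →L[ℝ] _).hasFDerivAt (x := x)
  refine h1.norm_sq.congr_fderiv ?_
  ext y
  simp only [InnerProductSpace.toDual_apply_apply, inner_smul_left]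
  simp only [smul_apply, ContinuousLinearMap.comp_apply, innerSL_apply_apply,
    inner_coordProj, real_inner_comm y, nsmul_eq_mul]
  simp [Finset.mul_sum, mul_ite]
  refine Finset.sum_congr rfl fun i _ => ?_
  split_ifs <;> ring

lemma hasGradientAt_apply_eq {f : EuclideanSpace ℝ (Fin n) → ℝ} {x g : EuclideanSpace ℝ (Fin n)}
    (h : HasGradientAt f g x) (i : Fin n) :
    HasLineDerivAt ℝ f (g i) x (EuclideanSpace.single i 1) := by
  have := h.hasFDerivAt.hasLineDerivAt (EuclideanSpace.single i 1)
  simpa [EuclideanSpace.inner_single_right] using this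

end PartialNorm

/-! ### Integration by parts against `X_j / |X_j|²` -/

section IntegrationByParts

variable {n : ℕ}

/-- The singular factor `g` is controlled only on `s`; near any point outside the support of `f` the
product is locally zero, whatever `g` does there. -/
lemma continuous_mul_of_tsupport_subset {X : Type*} [TopologicalSpace X] {f g : X → ℝ}
    {s : Set X} (hs : IsOpen s)
    (hf : Continuous f) (hfs : tsupport f ⊆ s) (hg : ContinuousOn g s) :
    Continuous fun x => f x * g x := by
  refine continuous_iff_continuousAt.2 fun x => ?_
  by_cases hx : x ∈ tsupport f
  · exact hf.continuousAt.mul (hg.continuousAt (hs.mem_nhds (hfs hx)))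
  · have : (fun x => f x * g x) =ᶠ[𝓝 x] fun _ => 0 := by
      filter_upwards [notMem_tsupport_iff_eventuallyEq.1 hx] with y hy
      simp [hy]
    exact this.continuousAt

lemma integrable_mul_of_tsupport_subset {f g : EuclideanSpace ℝ (Fin n) → ℝ}
    {s : Set (EuclideanSpace ℝ (Fin n))} (hs : IsOpen s) (hf : Continuous f)
    (hfc : HasCompactSupport f) (hfs : tsupport f ⊆ s) (hg : ContinuousOn g s) :
    Integrable fun x => f x * g x :=
  (continuous_mul_of_tsupport_subset hs hf hfs hg).integrable_of_hasCompactSupport hfc.mul_right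

lemma setIntegral_upperHalfSpace_eq [NeZero n] {u f : EuclideanSpace ℝ (Fin n) → ℝ}
    (hus : tsupport u ⊆ (upperHalfSpace n : Set (EuclideanSpace ℝ (Fin n))))
    (h : ∀ x, x ∉ tsupport u → f x = 0) :
    ∫ x in (upperHalfSpace n : Set (EuclideanSpace ℝ (Fin n))), f x = ∫ x, f x :=
  setIntegral_eq_integral_of_forall_compl_eq_zero fun x hx => h x fun hx' => hx (hus hx')

lemma gradient_eq_zero_of_notMem_tsupport {u : EuclideanSpace ℝ (Fin n) → ℝ}
    {x : EuclideanSpace ℝ (Fin n)} (hx : x ∉ tsupport u) : ∇ u x = 0 := by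
  have := notMem_tsupport_iff_eventuallyEq.1 hx
  have h : ∇ u x = ∇ (fun _ => (0 : ℝ)) x := by
    simp only [gradient, this.fderiv_eq]
    rfl
  rw [h]
  exact gradient_fun_const x 0

lemma continuous_gradient {u : EuclideanSpace ℝ (Fin n) → ℝ} (hu : ContDiff ℝ 1 u) :
    Continuous (∇ u) :=
  (InnerProductSpace.toDual ℝ _).symm.continuous.comp (hu.continuous_fderiv one_ne_zero)

lemma hasLineDerivAt_apply_div_partialNormSq {j : ℕ} {i : Fin n} (hi : i.val < j)
    {x : EuclideanSpace ℝ (Fin n)} (hx : partialNormSq j x ≠ 0) :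
    HasLineDerivAt ℝ (fun x : EuclideanSpace ℝ (Fin n) => x i / partialNormSq j x)
      (1 / partialNormSq j x - 2 * x i ^ 2 / partialNormSq j x ^ 2) x
      (EuclideanSpace.single i 1) := by
  have h1 : HasLineDerivAt ℝ (fun x : EuclideanSpace ℝ (Fin n) => x i) 1 x
      (EuclideanSpace.single i 1) := by
    have := (EuclideanSpace.proj i : EuclideanSpace ℝ (Fin n) →L[ℝ] ℝ).hasFDerivAt (x := x)
    simpa using this.hasLineDerivAt (EuclideanSpace.single i 1)
  have h2 := hasGradientAt_apply_eq (hasGradientAt_partialNormSq j x) i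
  unfold HasLineDerivAt at *
  have := h1.div h2 (by simpa using hx)
  refine this.congr_deriv ?_
  simp [hi]
  field_simp

/-- Integration by parts against one of the coordinates of `X_j / |X_j|²`. -/
lemma integral_mul_gradient_apply_div [NeZero n] {u : EuclideanSpace ℝ (Fin n) → ℝ}
    (hu : ContDiff ℝ 1 u) (huc : HasCompactSupport u)
    (hus : tsupport u ⊆ (upperHalfSpace n : Set (EuclideanSpace ℝ (Fin n))))
    {j : ℕ} (hj : 1 ≤ j) {i : Fin n} (hi : i.val < j) :
    ∫ x, 2 * u x * ∇ u x i * (x i / partialNormSq j x) =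
      - ∫ x, u x ^ 2 * (1 / partialNormSq j x - 2 * x i ^ 2 / partialNormSq j x ^ 2) := by
  have hΩ := (upperHalfSpace n).isOpen
  have hP : ∀ x ∈ (upperHalfSpace n : Set (EuclideanSpace ℝ (Fin n))), partialNormSq j x ≠ 0 :=
    fun x hx => (partialNormSq_pos hj hx).ne'
  have hsub : tsupport (fun x => u x ^ 2) ⊆ tsupport u :=
    closure_mono fun x hx h => hx (by simp [h])
  have hsub' : tsupport (fun x => 2 * u x * ∇ u x i) ⊆ tsupport u :=
    closure_mono fun x hx h => hx (by simp [h])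
  have hg : Continuous fun x => 2 * u x * ∇ u x i := by
    have := continuous_gradient hu
    have := hu.continuous
    fun_prop
  have hq : ContinuousOn (fun x => x i / partialNormSq j x)
      (upperHalfSpace n : Set (EuclideanSpace ℝ (Fin n))) :=
    ContinuousOn.div (by fun_prop) (by fun_prop) hP
  have hq' : ContinuousOn (fun x => 1 / partialNormSq j x - 2 * x i ^ 2 / partialNormSq j x ^ 2)
      (upperHalfSpace n : Set (EuclideanSpace ℝ (Fin n))) :=
    (ContinuousOn.div (by fun_prop) (by fun_prop) hP).sub
      (ContinuousOn.div (by fun_prop) (by fun_prop) fun x hx => pow_ne_zero 2 (hP x hx))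
  have hu2c : Continuous fun x => u x ^ 2 := hu.continuous.pow 2
  have hc2 : HasCompactSupport fun x => u x ^ 2 := huc.mono' (subset_closure.trans hsub)
  have hcg : HasCompactSupport fun x => 2 * u x * ∇ u x i :=
    huc.mono' (subset_closure.trans hsub')
  have key := integral_bilinear_hasLineDerivAt_right_eq_neg_left_of_integrable
    (μ := (volume : Measure (EuclideanSpace ℝ (Fin n))))
    (B := ContinuousLinearMap.mul ℝ ℝ) (v := EuclideanSpace.single i 1)
    (f := fun x => u x ^ 2) (f' := fun x => 2 * u x * ∇ u x i)
    (g := fun x => x i / partialNormSq j x)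
    (g' := fun x => 1 / partialNormSq j x - 2 * x i ^ 2 / partialNormSq j x ^ 2)
    (integrable_mul_of_tsupport_subset hΩ hg hcg (hsub'.trans hus) hq)
    (integrable_mul_of_tsupport_subset hΩ hu2c hc2 (hsub.trans hus) hq')
    (integrable_mul_of_tsupport_subset hΩ hu2c hc2 (hsub.trans hus) hq)
    (fun x _ => by
      have h1 := hasGradientAt_apply_eq ((hu.differentiable one_ne_zero) x).hasGradientAt i
      unfold HasLineDerivAt at *
      refine (h1.pow 2).congr_deriv ?_
      simp)
    (fun x hx => hasLineDerivAt_apply_div_partialNormSq hi (hP x (hus (hsub hx))))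
  simp only [ContinuousLinearMap.mul_apply'] at key
  rw [key, neg_neg]

/-- The divergence of `X_j / |X_j|²` is `(j - 2) / |X_j|²`, in integrated form. -/
lemma integral_mul_inner_gradient_coordProj [NeZero n] {u : EuclideanSpace ℝ (Fin n) → ℝ}
    (hu : ContDiff ℝ 1 u) (huc : HasCompactSupport u)
    (hus : tsupport u ⊆ (upperHalfSpace n : Set (EuclideanSpace ℝ (Fin n))))
    {j : ℕ} (hj : 1 ≤ j) (hjn : j ≤ n) :
    ∫ x, 2 * u x * (inner ℝ (∇ u x) (coordProj j x) / partialNormSq j x) =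
      - ((j - 2 : ℝ) * ∫ x, u x ^ 2 / partialNormSq j x) := by
  have hΩ := (upperHalfSpace n).isOpen
  have hP : ∀ x ∈ (upperHalfSpace n : Set (EuclideanSpace ℝ (Fin n))), partialNormSq j x ≠ 0 :=
    fun x hx => (partialNormSq_pos hj hx).ne'
  have hgc := continuous_gradient hu
  have huc0 := hu.continuous
  have hsum : ∀ x, 2 * u x * (inner ℝ (∇ u x) (coordProj j x) / partialNormSq j x) =
      ∑ i : Fin n with i.val < j, 2 * u x * ∇ u x i * (x i / partialNormSq j x) := by
    intro x
    rw [inner_coordProj, Finset.sum_filter, Finset.sum_div, Finset.mul_sum]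
    refine Finset.sum_congr rfl fun i _ => ?_
    split_ifs <;> ring
  simp_rw [hsum]
  rw [integral_finsetSum, Finset.sum_congr rfl fun i hi => integral_mul_gradient_apply_div
    hu huc hus hj (Finset.mem_filter.1 hi).2, Finset.sum_neg_distrib, ← integral_finsetSum,
    ← integral_const_mul]
  · congr 1
    refine integral_congr_ae (ae_of_all _ fun x => ?_)
    by_cases hx : x ∈ tsupport u
    · have h0 := hP x (hus hx)
      have hcard : ((Finset.univ.filter fun i : Fin n => i.val < j).card : ℝ) = j := by
        norm_cast
        rw [Fin.card_filter_val_lt, min_eq_right hjn]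
      have : ∑ i : Fin n with i.val < j, 2 * x i ^ 2 / partialNormSq j x ^ 2 =
          2 / partialNormSq j x := by
        rw [← Finset.sum_div, ← Finset.mul_sum]
        change 2 * partialNormSq j x / _ = _
        field_simp
      simp only [← Finset.mul_sum, Finset.sum_sub_distrib, this, Finset.sum_const, hcard,
        nsmul_eq_mul]
      field_simp
    · simp [image_eq_zero_of_notMem_tsupport hx]
  · intro i _
    refine integrable_mul_of_tsupport_subset hΩ (by fun_prop) (huc.mono' ?_)
      ((closure_mono ?_).trans hus)
      ((ContinuousOn.div (by fun_prop) (by fun_prop) hP).sub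
      (ContinuousOn.div (by fun_prop) (by fun_prop) fun x hx => pow_ne_zero 2 (hP x hx)))
    · exact fun x hx => subset_closure fun h => hx (by simp [h])
    · exact fun x hx h => hx (by simp [h])
  · intro i _
    refine integrable_mul_of_tsupport_subset hΩ (by fun_prop) (huc.mono' ?_)
      ((closure_mono ?_).trans hus) (ContinuousOn.div (by fun_prop) (by fun_prop) hP)
    · exact fun x hx => subset_closure fun h => hx (by simp [h])
    · exact fun x hx h => hx (by simp [h])

end IntegrationByParts

/-! ### Ground state representation of the Hardy energy -/

/-- The coefficients `γ_j` of the ground state `∏ |X_j| ^ (-γ_j)`. -/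
noncomputable def hardyExponent (A : ℕ → ℝ) (j : ℕ) : ℝ := A j - A (j - 1) + 1 / 2

/-- The logarithmic gradient `-∑ γ_j X_j / |X_j|²` of the ground state. -/
noncomputable def groundField {n : ℕ} (A : ℕ → ℝ) (M : ℕ) (x : EuclideanSpace ℝ (Fin n)) :
    EuclideanSpace ℝ (Fin n) :=
  -∑ j ∈ Finset.Icc 1 M, (hardyExponent A j / partialNormSq j x) • coordProj j x

/-- The Hardy constant attached to `|X_j|⁻²`. -/
noncomputable def hardyConst (A : ℕ → ℝ) (j : ℕ) : ℝ := -(A j) ^ 2 + (A (j - 1) - 1 / 2) ^ 2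

section Identity

variable {n : ℕ}

lemma groundField_succ (A : ℕ → ℝ) (M : ℕ) (x : EuclideanSpace ℝ (Fin n)) :
    groundField A (M + 1) x = groundField A M x -
      (hardyExponent A (M + 1) / partialNormSq (M + 1) x) • coordProj (M + 1) x := by
  simp only [groundField]
  rw [Finset.sum_Icc_succ_top (by omega), neg_add, sub_eq_add_neg]

lemma sum_hardyExponent (A : ℕ → ℝ) (M : ℕ) :
    ∑ j ∈ Finset.Icc 1 M, hardyExponent A j = A M - A 0 + M / 2 := by
  induction M with
  | zero => simp
  | succ M ih =>
    rw [Finset.sum_Icc_succ_top (by omega), ih, hardyExponent]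
    push_cast
    ring

/-- Each summand contributes `-γ_j` since `⟨X_j, X_l⟩ = |X_j|²`, and the sum of the `γ_j`
telescopes; the value does not depend on `x`. -/
lemma inner_groundField_coordProj [NeZero n] (A : ℕ → ℝ) {M l : ℕ} (hl : M ≤ l)
    {x : EuclideanSpace ℝ (Fin n)}
    (hx : x ∈ (upperHalfSpace n : Set (EuclideanSpace ℝ (Fin n)))) :
    inner ℝ (groundField A M x) (coordProj l x) = -(A M - A 0 + M / 2) := by
  rw [groundField, inner_neg_left, sum_inner, ← sum_hardyExponent]
  congr 1
  refine Finset.sum_congr rfl fun j hj => ?_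
  rw [Finset.mem_Icc] at hj
  rw [real_inner_smul_left, inner_coordProj_coordProj (hj.2.trans hl),
    div_mul_cancel₀ _ (partialNormSq_pos hj.1 hx).ne']

/-- Adding the term with `X_{M+1}` creates a cross term that is a constant over `|X_{M+1}|²`, so the
coefficient of `|X_j|⁻²` is `γ_j² + 2 γ_j ∑_{i<j} γ_i`. -/
lemma norm_sq_groundField [NeZero n] (A : ℕ → ℝ) (M : ℕ) {x : EuclideanSpace ℝ (Fin n)}
    (hx : x ∈ (upperHalfSpace n : Set (EuclideanSpace ℝ (Fin n)))) :
    ‖groundField A M x‖ ^ 2 = ∑ j ∈ Finset.Icc 1 M,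
      hardyExponent A j * (hardyExponent A j + 2 * (A (j - 1) - A 0 + (j - 1) / 2)) /
        partialNormSq j x := by
  induction M with
  | zero => simp [groundField]
  | succ M ih =>
    have hP := (partialNormSq_pos (Nat.le_add_left 1 M) hx).ne'
    rw [Finset.sum_Icc_succ_top (by omega), ← ih, groundField_succ, norm_sub_sq_real,
      real_inner_smul_right, inner_groundField_coordProj A (Nat.le_succ M) hx, norm_smul, mul_pow,
      norm_sq_coordProj, Real.norm_eq_abs, sq_abs]
    push_cast
    field_simp
    ring

lemma continuousOn_div_partialNormSq [NeZero n] {f : EuclideanSpace ℝ (Fin n) → ℝ} (hf : Continuous f) {j : ℕ}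
    (hj : 1 ≤ j) : ContinuousOn (fun x => f x / partialNormSq j x)
      (upperHalfSpace n : Set (EuclideanSpace ℝ (Fin n))) :=
  ContinuousOn.div hf.continuousOn (by fun_prop) fun _ hx => (partialNormSq_pos hj hx).ne'

lemma integrable_sq_div_partialNormSq [NeZero n] {u : EuclideanSpace ℝ (Fin n) → ℝ}
    (hu : Continuous u) (huc : HasCompactSupport u)
    (hus : tsupport u ⊆ (upperHalfSpace n : Set (EuclideanSpace ℝ (Fin n))))
    {j : ℕ} (hj : 1 ≤ j) : Integrable fun x => u x ^ 2 / partialNormSq j x := by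
  have hsub : tsupport (fun x => u x ^ 2) ⊆ tsupport u :=
    closure_mono fun x hx h => hx (by simp [h])
  have := integrable_mul_of_tsupport_subset (upperHalfSpace n).isOpen (hu.pow 2)
    (huc.mono' (subset_closure.trans hsub)) (hsub.trans hus)
    (continuousOn_div_partialNormSq continuous_const hj (f := fun _ => (1 : ℝ)))
  simpa [div_eq_mul_inv] using this

lemma integrable_norm_gradient_sq {u : EuclideanSpace ℝ (Fin n) → ℝ}
    (hu : ContDiff ℝ 1 u) (huc : HasCompactSupport u) : Integrable fun x => ‖∇ u x‖ ^ 2 := by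
  have hg := continuous_gradient hu
  refine Continuous.integrable_of_hasCompactSupport (by fun_prop) (huc.mono' fun x hx => ?_)
  by_contra h
  exact hx (by simp [gradient_eq_zero_of_notMem_tsupport h])

/-- The ground state representation of the Hardy energy. -/
theorem dirichletIntegral_sub_sum_hardyIntegral [NeZero n] {u : EuclideanSpace ℝ (Fin n) → ℝ}
    (hu : ContDiff ℝ 1 u) (huc : HasCompactSupport u)
    (hus : tsupport u ⊆ (upperHalfSpace n : Set (EuclideanSpace ℝ (Fin n))))
    {A : ℕ → ℝ} (hA : A 0 = 1) {M : ℕ} (hM : M ≤ n) :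
    dirichletIntegral u - ∑ j ∈ Finset.Icc 1 M, hardyConst A j * hardyIntegral j u =
      ∫ x in (upperHalfSpace n : Set (EuclideanSpace ℝ (Fin n))),
        ‖∇ u x - u x • groundField A M x‖ ^ 2 := by
  have hI1 := integrable_norm_gradient_sq hu huc
  have hgc := continuous_gradient hu
  have hIj : ∀ j ∈ Finset.Icc 1 M, Integrable fun x => u x ^ 2 / partialNormSq j x :=
    fun j hj => integrable_sq_div_partialNormSq hu.continuous huc hus (Finset.mem_Icc.1 hj).1
  have hJj : ∀ j ∈ Finset.Icc 1 M, Integrable fun x =>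
      2 * u x * (inner ℝ (∇ u x) (coordProj j x) / partialNormSq j x) := by
    intro j hj
    have hsub : tsupport (fun x => 2 * u x) ⊆ tsupport u :=
      closure_mono fun x hx h => hx (by simp [h])
    refine integrable_mul_of_tsupport_subset (upperHalfSpace n).isOpen
      (continuous_const.mul hu.continuous) (huc.mono' (subset_closure.trans hsub)) (hsub.trans hus)
      (continuousOn_div_partialNormSq (by fun_prop) (Finset.mem_Icc.1 hj).1)
  have expand : ∀ x ∈ (upperHalfSpace n : Set (EuclideanSpace ℝ (Fin n))),
      ‖∇ u x - u x • groundField A M x‖ ^ 2 = ‖∇ u x‖ ^ 2 + ∑ j ∈ Finset.Icc 1 M,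
        (hardyExponent A j * (2 * u x * (inner ℝ (∇ u x) (coordProj j x) / partialNormSq j x)) +
        hardyExponent A j * (hardyExponent A j + 2 * (A (j - 1) - A 0 + (j - 1) / 2)) *
          (u x ^ 2 / partialNormSq j x)) := by
    intro x hx
    rw [norm_sub_sq_real, norm_smul, mul_pow, norm_sq_groundField A M hx, Real.norm_eq_abs, sq_abs,
      real_inner_smul_right, groundField, inner_neg_right, inner_sum, Finset.sum_add_distrib,
      Finset.mul_sum, sub_add, sub_eq_add_neg]
    congr 1
    rw [neg_sub, sub_eq_add_neg, add_comm]
    congr 1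
    · simp only [mul_neg, neg_neg, Finset.mul_sum]
      refine Finset.sum_congr rfl fun j _ => ?_
      rw [real_inner_smul_right]
      ring
    · exact Finset.sum_congr rfl fun j _ => by ring
  have hS : ∀ j ∈ Finset.Icc 1 M, Integrable fun x => hardyExponent A j *
      (2 * u x * (inner ℝ (∇ u x) (coordProj j x) / partialNormSq j x)) +
        hardyExponent A j * (hardyExponent A j + 2 * (A (j - 1) - A 0 + (j - 1) / 2)) *
          (u x ^ 2 / partialNormSq j x) :=
    fun j hj => ((hJj j hj).const_mul _).add ((hIj j hj).const_mul _)
  rw [setIntegral_congr_fun (upperHalfSpace n).isOpen.measurableSet expand, integral_add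
    hI1.integrableOn (integrable_finsetSum _ fun j hj => (hS j hj).integrableOn),
    integral_finsetSum _ fun j hj => (hS j hj).integrableOn, dirichletIntegral,
    sub_eq_add_neg, ← Finset.sum_neg_distrib]
  congr 1
  refine Finset.sum_congr rfl fun j hj => ?_
  obtain ⟨h1, h2⟩ := Finset.mem_Icc.1 hj
  -- The divergence contributes `-γ_j (j - 2)`. With `A 0 = 1` the total coefficient is `γ_j (γ_j +
  -- 2 A_{j-1} - 1) = (A_j - A_{j-1} + 1/2)(A_j + A_{j-1} - 1/2) = A_j² - (A_{j-1} - 1/2)²`.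
  rw [integral_add ((hJj j hj).const_mul _).integrableOn ((hIj j hj).const_mul _).integrableOn,
    integral_const_mul, integral_const_mul, hardyIntegral,
    setIntegral_upperHalfSpace_eq (u := u) hus
      (fun x hx => by simp [image_eq_zero_of_notMem_tsupport hx]),
    setIntegral_upperHalfSpace_eq (u := u) hus
      (fun x hx => by simp [image_eq_zero_of_notMem_tsupport hx]),
    integral_mul_inner_gradient_coordProj hu huc hus h1 (h2.trans hM), hardyConst, hardyExponent, hA]
  ring

end Identity

/-! ### The ground state and the substitution `u = φ v` -/

/-- The squared ground state `∏ |X_j| ^ (-2 γ_j)`. -/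
noncomputable def groundWeight {n : ℕ} (A : ℕ → ℝ) (M : ℕ) (x : EuclideanSpace ℝ (Fin n)) : ℝ :=
  ∏ j ∈ Finset.Icc 1 M, partialNormSq j x ^ (-hardyExponent A j)

/-- The ground state `∏ |X_j| ^ (-γ_j)`. -/
noncomputable def groundState {n : ℕ} (A : ℕ → ℝ) (M : ℕ) (x : EuclideanSpace ℝ (Fin n)) : ℝ :=
  ∏ j ∈ Finset.Icc 1 M, partialNormSq j x ^ (-hardyExponent A j / 2)

section GroundState

variable {n : ℕ}

lemma groundState_succ (A : ℕ → ℝ) (M : ℕ) (x : EuclideanSpace ℝ (Fin n)) :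
    groundState A (M + 1) x =
      groundState A M x * partialNormSq (M + 1) x ^ (-hardyExponent A (M + 1) / 2) :=
  Finset.prod_Icc_succ_top (by omega) _

lemma groundWeight_succ (A : ℕ → ℝ) (M : ℕ) (x : EuclideanSpace ℝ (Fin n)) :
    groundWeight A (M + 1) x =
      groundWeight A M x * partialNormSq (M + 1) x ^ (-hardyExponent A (M + 1)) :=
  Finset.prod_Icc_succ_top (by omega) _

lemma groundState_sq (A : ℕ → ℝ) (M : ℕ) (x : EuclideanSpace ℝ (Fin n)) :
    groundState A M x ^ 2 = groundWeight A M x := by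
  rw [groundState, groundWeight, ← Finset.prod_pow]
  refine Finset.prod_congr rfl fun j _ => ?_
  rw [← Real.rpow_mul_natCast (partialNormSq_nonneg j x)]
  congr 1
  push_cast
  ring

lemma groundWeight_nonneg (A : ℕ → ℝ) (M : ℕ) (x : EuclideanSpace ℝ (Fin n)) :
    0 ≤ groundWeight A M x :=
  Finset.prod_nonneg fun j _ => Real.rpow_nonneg (partialNormSq_nonneg j x) _

lemma groundWeight_pos [NeZero n] (A : ℕ → ℝ) (M : ℕ) {x : EuclideanSpace ℝ (Fin n)}
    (hx : x ∈ (upperHalfSpace n : Set (EuclideanSpace ℝ (Fin n)))) : 0 < groundWeight A M x :=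
  Finset.prod_pos fun _ hj => Real.rpow_pos_of_pos (partialNormSq_pos (Finset.mem_Icc.1 hj).1 hx) _

@[fun_prop]
lemma measurable_groundWeight (A : ℕ → ℝ) (M : ℕ) :
    Measurable (groundWeight A M : EuclideanSpace ℝ (Fin n) → ℝ) := by
  unfold groundWeight
  fun_prop

lemma contDiffAt_groundState [NeZero n] (A : ℕ → ℝ) (M : ℕ) {x : EuclideanSpace ℝ (Fin n)}
    (hx : x ∈ (upperHalfSpace n : Set (EuclideanSpace ℝ (Fin n)))) {k : WithTop ℕ∞} :
    ContDiffAt ℝ k (groundState A M) x :=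
  contDiffAt_prod fun _ hj => (contDiff_partialNormSq _).contDiffAt.rpow_const_of_ne
    (partialNormSq_pos (Finset.mem_Icc.1 hj).1 hx).ne'

lemma HasGradientAt.mul' {E : Type*} [NormedAddCommGroup E] [InnerProductSpace ℝ E]
    [CompleteSpace E] {f g : E → ℝ} {f' g' x : E}
    (hf : HasGradientAt f f' x) (hg : HasGradientAt g g' x) :
    HasGradientAt (fun x => f x * g x) (f x • g' + g x • f') x := by
  rw [hasGradientAt_iff_hasFDerivAt] at *
  have h := hf.mul hg
  refine HasFDerivAt.congr_fderiv h ?_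
  simp

lemma HasDerivAt.comp_hasGradientAt' {E : Type*} [NormedAddCommGroup E] [InnerProductSpace ℝ E]
    [CompleteSpace E] {f : E → ℝ} {h : ℝ → ℝ} {f' x : E} {h' : ℝ}
    (hh : HasDerivAt h h' (f x)) (hf : HasGradientAt f f' x) :
    HasGradientAt (fun x => h (f x)) (h' • f') x := by
  rw [hasGradientAt_iff_hasFDerivAt] at *
  have h := hh.comp_hasFDerivAt x hf
  refine HasFDerivAt.congr_fderiv h ?_
  simp

lemma hasGradientAt_groundState [NeZero n] (A : ℕ → ℝ) (M : ℕ) {x : EuclideanSpace ℝ (Fin n)}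
    (hx : x ∈ (upperHalfSpace n : Set (EuclideanSpace ℝ (Fin n)))) :
    HasGradientAt (groundState A M) (groundState A M x • groundField A M x) x := by
  induction M with
  | zero =>
    have : (groundState A 0 : EuclideanSpace ℝ (Fin n) → ℝ) = fun _ => 1 := by
      ext; simp [groundState]
    simpa [this, groundField] using hasGradientAt_const x (1 : ℝ)
  | succ M ih =>
    have hP := partialNormSq_pos (Nat.le_add_left 1 M) hx
    have h1 := (Real.hasDerivAt_rpow_const (p := -hardyExponent A (M + 1) / 2)
      (Or.inl hP.ne')).comp_hasGradientAt' (hasGradientAt_partialNormSq (M + 1) x)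
    have h2 := ih.mul' h1
    have h3 : (groundState A (M + 1) : EuclideanSpace ℝ (Fin n) → ℝ) = fun x =>
        groundState A M x * partialNormSq (M + 1) x ^ (-hardyExponent A (M + 1) / 2) :=
      funext (groundState_succ A M)
    rw [h3]
    convert h2 using 1
    beta_reduce
    rw [groundField_succ, smul_sub, smul_smul, smul_smul, smul_smul, smul_smul, sub_eq_neg_add,
      ← neg_smul, mul_comm (partialNormSq (M + 1) x ^ _) (groundState A M x)]
    congr 2
    rw [Real.rpow_sub_one hP.ne']
    field_simp

/-- The test function that equals the ground state times `v` on the half-space. -/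
noncomputable def groundTest [NeZero n] (A : ℕ → ℝ) (M : ℕ) (v : EuclideanSpace ℝ (Fin n) → ℝ)
    (hv : ContDiff ℝ ((⊤ : ℕ∞) : WithTop ℕ∞) v) (hvc : HasCompactSupport v)
    (hvs : tsupport v ⊆ {x | partialNormSq 1 x ≠ 0}) : 𝓓(upperHalfSpace n, ℝ) where
  toFun := (upperHalfSpace n : Set (EuclideanSpace ℝ (Fin n))).indicator
    fun x => groundState A M x * v x
  contDiff' := by
    refine contDiff_iff_contDiffAt.2 fun x => ?_
    by_cases hxv : x ∈ tsupport v
    swap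
    · have : (upperHalfSpace n : Set (EuclideanSpace ℝ (Fin n))).indicator
          (fun x => groundState A M x * v x) =ᶠ[𝓝 x] fun _ => 0 := by
        filter_upwards [notMem_tsupport_iff_eventuallyEq.1 hxv] with y hy
        simp [hy]
      exact contDiffAt_const.congr_of_eventuallyEq this
    -- On the support of `v` the boundary hyperplane is avoided, so `x` lies in one of two open
    -- half-spaces: the indicator is locally `0` on one and locally `1` on the other, and truncation
    -- preserves smoothness.
    have hx0 : x 0 ≠ 0 := by
      have := hvs hxv
      exact fun h => this (by simp [partialNormSq_one, h])
    rcases hx0.lt_or_gt with h | h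
    · have : (upperHalfSpace n : Set (EuclideanSpace ℝ (Fin n))).indicator
          (fun x => groundState A M x * v x) =ᶠ[𝓝 x] fun _ => 0 := by
        have ho : IsOpen {y : EuclideanSpace ℝ (Fin n) | y 0 < 0} :=
          isOpen_lt (by fun_prop) continuous_const
        filter_upwards [ho.mem_nhds h] with y hy
        exact indicator_of_notMem (fun h' => lt_asymm hy (mem_upperHalfSpace.1 h')) _
      exact contDiffAt_const.congr_of_eventuallyEq this
    · have : (upperHalfSpace n : Set (EuclideanSpace ℝ (Fin n))).indicator
          (fun x => groundState A M x * v x) =ᶠ[𝓝 x] fun x => groundState A M x * v x := by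
        filter_upwards [(upperHalfSpace n).isOpen.mem_nhds h] with y hy
        exact indicator_of_mem hy _
      exact ((contDiffAt_groundState A M h).mul hv.contDiffAt).congr_of_eventuallyEq this
  hasCompactSupport' := hvc.mono fun y hy hv0 => Function.mem_support.1 hy (by simp [hv0])
  tsupport_subset' := by
    intro x hx
    have hxv : x ∈ tsupport v :=
      closure_mono (t := Function.support v)
        (fun y hy hv0 => Function.mem_support.1 hy (by simp [hv0])) hx
    have hx0 : x 0 ≠ 0 := by
      have := hvs hxv
      exact fun h => this (by simp [partialNormSq_one, h])
    have hcl : IsClosed {y : EuclideanSpace ℝ (Fin n) | 0 ≤ y 0} :=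
      isClosed_le continuous_const (by fun_prop)
    have : x ∈ {y : EuclideanSpace ℝ (Fin n) | 0 ≤ y 0} :=
      closure_minimal (fun y hy => by
        by_contra h'
        refine Function.mem_support.1 hy (indicator_of_notMem (fun h => h' ?_) _)
        exact (mem_upperHalfSpace.1 h).le) hcl hx
    exact lt_of_le_of_ne this hx0.symm

lemma groundTest_apply [NeZero n] {A : ℕ → ℝ} {M : ℕ} {v : EuclideanSpace ℝ (Fin n) → ℝ}
    (hv : ContDiff ℝ ((⊤ : ℕ∞) : WithTop ℕ∞) v) (hvc : HasCompactSupport v)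
    (hvs : tsupport v ⊆ {x | partialNormSq 1 x ≠ 0}) {x : EuclideanSpace ℝ (Fin n)}
    (hx : x ∈ (upperHalfSpace n : Set (EuclideanSpace ℝ (Fin n)))) :
    groundTest A M v hv hvc hvs x = groundState A M x * v x :=
  indicator_of_mem (f := fun x => groundState A M x * v x) hx

/-- Since `∇φ = φ F`, the product rule leaves `∇(φ v) - φ v F = φ ∇v`. -/
lemma norm_gradient_groundTest_sub [NeZero n] {A : ℕ → ℝ} {M : ℕ}
    {v : EuclideanSpace ℝ (Fin n) → ℝ}
    (hv : ContDiff ℝ ((⊤ : ℕ∞) : WithTop ℕ∞) v) (hvc : HasCompactSupport v)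
    (hvs : tsupport v ⊆ {x | partialNormSq 1 x ≠ 0}) {x : EuclideanSpace ℝ (Fin n)}
    (hx : x ∈ (upperHalfSpace n : Set (EuclideanSpace ℝ (Fin n)))) :
    ‖∇ (groundTest A M v hv hvc hvs) x - groundTest A M v hv hvc hvs x • groundField A M x‖ ^ 2 =
      groundWeight A M x * ‖∇ v x‖ ^ 2 := by
  have h1 := (hasGradientAt_groundState A M hx).mul'
    ((hv.differentiable (by simp)) x).hasGradientAt
  have h2 : groundTest A M v hv hvc hvs =ᶠ[𝓝 x] fun x => groundState A M x * v x := by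
    filter_upwards [(upperHalfSpace n).isOpen.mem_nhds hx] with y hy
    exact groundTest_apply hv hvc hvs hy
  rw [(h1.congr_of_eventuallyEq h2).gradient, groundTest_apply hv hvc hvs hx, smul_smul,
    mul_comm (v x), add_sub_cancel_right, norm_smul, mul_pow, Real.norm_eq_abs, sq_abs,
    groundState_sq]

end GroundState

/-! ### Dilations of the first `m` coordinates -/

section PartialDilation

variable {n : ℕ}

/-- Dilation by `c` of the first `m` coordinates. -/
noncomputable def partialDilation (m : ℕ) (c : ℝ) :
    EuclideanSpace ℝ (Fin n) →ₗ[ℝ] EuclideanSpace ℝ (Fin n) :=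
  Matrix.toEuclideanLin (Matrix.diagonal fun i : Fin n => if i.val < m then c else 1)

lemma partialDilation_apply (m : ℕ) (c : ℝ) (x : EuclideanSpace ℝ (Fin n)) (i : Fin n) :
    partialDilation m c x i = if i.val < m then c * x i else x i := by
  simp only [partialDilation, Matrix.toLpLin_apply, Matrix.mulVec_diagonal]
  split_ifs <;> simp

lemma det_partialDilation {m : ℕ} (hm : m ≤ n) (c : ℝ) :
    LinearMap.det (partialDilation m c : EuclideanSpace ℝ (Fin n) →ₗ[ℝ] _) = c ^ m := by
  rw [partialDilation, Matrix.toEuclideanLin, Matrix.toLpLin_eq_toLin, LinearMap.det_toLin,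
    Matrix.det_diagonal, ← Finset.prod_filter, Finset.prod_const, Fin.card_filter_val_lt,
    min_eq_right hm]

lemma partialNormSq_partialDilation {j m : ℕ} (hj : j ≤ m) (c : ℝ)
    (x : EuclideanSpace ℝ (Fin n)) :
    partialNormSq j (partialDilation m c x) = c ^ 2 * partialNormSq j x := by
  rw [partialNormSq_eq_sum_ite, partialNormSq_eq_sum_ite, Finset.mul_sum]
  refine Finset.sum_congr rfl fun i _ => ?_
  rw [partialDilation_apply]
  by_cases h : i.val < j
  · simp [h, h.trans_le hj, mul_pow]
  · simp [h]

lemma lintegral_comp_partialDilation {m : ℕ} (hm : m ≤ n) {c : ℝ} (hc : 0 < c)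
    {F : EuclideanSpace ℝ (Fin n) → ℝ≥0∞} (hF : Measurable F) :
    ∫⁻ x, F (partialDilation m c x) = ENNReal.ofReal ((c ^ m)⁻¹) * ∫⁻ x, F x := by
  have hdet := det_partialDilation (n := n) hm c
  have h := Measure.map_linearMap_addHaar_eq_smul_addHaar
    (volume : Measure (EuclideanSpace ℝ (Fin n))) (f := partialDilation m c)
    (by rw [hdet]; positivity)
  rw [hdet, abs_of_pos (by positivity)] at h
  have hD : Measurable (partialDilation m c : EuclideanSpace ℝ (Fin n) →ₗ[ℝ] _) :=
    (LinearMap.continuous_of_finiteDimensional _).measurable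
  rw [← lintegral_map hF hD, h, lintegral_smul_measure, smul_eq_mul]

lemma groundWeight_partialDilation (A : ℕ → ℝ) (m : ℕ) {c : ℝ} (hc : 0 < c)
    (x : EuclideanSpace ℝ (Fin n)) :
    groundWeight A m (partialDilation m c x) =
      (c ^ 2) ^ (-(A m - A 0 + m / 2)) * groundWeight A m x := by
  rw [← sum_hardyExponent, ← Finset.sum_neg_distrib,
    Real.rpow_sum_of_pos (by positivity), groundWeight, groundWeight, ← Finset.prod_mul_distrib]
  refine Finset.prod_congr rfl fun j hj => ?_
  rw [partialNormSq_partialDilation (Finset.mem_Icc.1 hj).2,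
    Real.mul_rpow (by positivity) (partialNormSq_nonneg j x)]

end PartialDilation

/-! ### The scale-invariant measure in the variable `log |X_m|²` -/

section LogMeasure

variable {n : ℕ}

open Classical in
/-- The density `w_m |X_m| ^ (2 A_m - 2)`, cut off in the coordinates beyond the first `m`. It is
homogeneous of degree `-m` in the first `m` coordinates. -/
noncomputable def radialDensity [NeZero n] (A : ℕ → ℝ) (m : ℕ) (R : ℝ) (x : EuclideanSpace ℝ (Fin n)) :
    ℝ≥0∞ :=
  if 0 < x 0 ∧ ∀ i : Fin n, m ≤ i.val → |x i| ≤ R then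
    ENNReal.ofReal (groundWeight A m x * partialNormSq m x ^ (A m - 1)) else 0

@[fun_prop]
lemma measurable_radialDensity [NeZero n] (A : ℕ → ℝ) (m : ℕ) (R : ℝ) :
    Measurable (radialDensity A m R : EuclideanSpace ℝ (Fin n) → ℝ≥0∞) := by
  have hm : Measurable fun x : EuclideanSpace ℝ (Fin n) =>
      ENNReal.ofReal (groundWeight A m x * partialNormSq m x ^ (A m - 1)) := by fun_prop
  refine Measurable.ite ?_ hm measurable_const
  have h : {x : EuclideanSpace ℝ (Fin n) | 0 < x 0 ∧ ∀ i : Fin n, m ≤ i.val → |x i| ≤ R} =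
      (upperHalfSpace n : Set (EuclideanSpace ℝ (Fin n))) ∩
        ⋂ i : Fin n, ⋂ _ : m ≤ i.val, {x | |x i| ≤ R} := by
    ext x
    simp only [mem_inter_iff, mem_iInter]
    exact Iff.rfl
  rw [h]
  exact (upperHalfSpace n).isOpen.measurableSet.inter (MeasurableSet.iInter fun i =>
    MeasurableSet.iInter fun _ => (isClosed_le (by fun_prop) continuous_const).measurableSet)

/-- Degree count: `φ_m²` has degree `-2 (A_m - 1 + m/2)` and the extra power has degree `2 A_m - 2`,
which add up to `-m`. The cutoff involves only coordinates that are not dilated. -/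
lemma radialDensity_partialDilation [NeZero n] {A : ℕ → ℝ} (hA : A 0 = 1) {m : ℕ} (hm : 1 ≤ m) (R : ℝ)
    {c : ℝ} (hc : 0 < c) (x : EuclideanSpace ℝ (Fin n)) :
    radialDensity A m R (partialDilation m c x) =
      ENNReal.ofReal ((c ^ m)⁻¹) * radialDensity A m R x := by
  have hcond : (0 < partialDilation m c x 0 ∧ ∀ i : Fin n, m ≤ i.val →
      |partialDilation m c x i| ≤ R) ↔ (0 < x 0 ∧ ∀ i : Fin n, m ≤ i.val → |x i| ≤ R) := by
    have h0 : ((0 : Fin n) : ℕ) < m := by simpa using Nat.lt_of_lt_of_le one_pos hm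
    refine and_congr ?_ (forall_congr' fun i => imp_congr_right fun hi => ?_)
    · rw [partialDilation_apply, if_pos h0, mul_pos_iff_of_pos_left hc]
    · rw [partialDilation_apply, if_neg (by omega)]
  unfold radialDensity
  simp only [hcond]
  split_ifs with h
  · rw [← ENNReal.ofReal_mul (by positivity), groundWeight_partialDilation A m hc,
      partialNormSq_partialDilation le_rfl, Real.mul_rpow (by positivity) (partialNormSq_nonneg m x),
      mul_mul_mul_comm, ← Real.rpow_add (by positivity), ← Real.rpow_natCast c 2,
      ← Real.rpow_mul hc.le, ← Real.rpow_natCast c m, ← Real.rpow_neg hc.le, hA]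
    congr 3
    push_cast
    ring
  · simp

/-- The image of the measure with density `radialDensity` under `log |X_m|²`. -/
noncomputable def logMeasure (n : ℕ) [NeZero n] (A : ℕ → ℝ) (m : ℕ) (R : ℝ) : Measure ℝ :=
  ((volume : Measure (EuclideanSpace ℝ (Fin n))).withDensity (radialDensity A m R)).map
    fun x => Real.log (partialNormSq m x)

lemma lintegral_logMeasure [NeZero n] (A : ℕ → ℝ) (m : ℕ) (R : ℝ) {G : ℝ → ℝ≥0∞} (hG : Measurable G) :
    ∫⁻ t, G t ∂(logMeasure n A m R) =
      ∫⁻ x : EuclideanSpace ℝ (Fin n), radialDensity A m R x * G (Real.log (partialNormSq m x)) := by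
  rw [logMeasure, lintegral_map hG (by fun_prop),
    lintegral_withDensity_eq_lintegral_mul _ (by fun_prop) (by fun_prop)]
  rfl

/-- Dilating by `e^(a/2)` translates `log |X_m|²` by `a`, and the Jacobian cancels the homogeneity
factor of the density. -/
lemma isAddLeftInvariant_logMeasure [NeZero n] {A : ℕ → ℝ} (hA : A 0 = 1) {m : ℕ} (hm : 1 ≤ m) (hmn : m ≤ n)
    (R : ℝ) : (logMeasure n A m R).IsAddLeftInvariant := by
  refine ⟨fun a => Measure.ext_of_lintegral _ fun G hG => ?_⟩
  rw [lintegral_map hG (by fun_prop), lintegral_logMeasure A m R (by fun_prop),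
    lintegral_logMeasure A m R hG]
  have hc := Real.exp_pos (a / 2)
  have key := lintegral_comp_partialDilation hmn hc (F := fun x : EuclideanSpace ℝ (Fin n) =>
    radialDensity A m R x * G (Real.log (partialNormSq m x))) (by fun_prop)
  have hcm : 0 < (Real.exp (a / 2) ^ m)⁻¹ := by positivity
  rw [← ENNReal.mul_right_inj (ENNReal.ofReal_pos.2 hcm).ne' ENNReal.ofReal_ne_top, ← key,
    ← lintegral_const_mul _ (by fun_prop)]
  refine lintegral_congr fun x => ?_
  rw [radialDensity_partialDilation hA hm R hc, mul_assoc]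
  by_cases hx : x ∈ (upperHalfSpace n : Set (EuclideanSpace ℝ (Fin n)))
  · rw [partialNormSq_partialDilation le_rfl, Real.log_mul (by positivity)
      (partialNormSq_pos hm hx).ne', ← Real.exp_nat_mul (a / 2) 2, Real.log_exp]
    congr 4
    push_cast
    ring
  · have : radialDensity A m R x = 0 := if_neg fun h => hx h.1
    simp [this]

/-- Passing from `m` to `m + 1` multiplies by `|X_{m+1}|^(2 A_m - 1 - 2 A_{m+1})`. The part
`|X_{m+1}|^(2 A_m)` is absorbed by `|X_m|^(-2 A_m)` because `A_m ≤ 0`. The part `|X_{m+1}|⁻¹` is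
split as at most `x₁^(-1/n) |x_{m+1}|^(-(1 - 1/n))`: the second factor is integrable in one
variable, and at most `n - 1` factors of the first kind are paid for by the initial power of `x₁`.
-/
lemma groundWeight_le [NeZero n] {A : ℕ → ℝ} (hA : A 0 = 1) {m : ℕ} (hm : 1 ≤ m) (hmn : m ≤ n)
    (hA' : ∀ j, 1 ≤ j → j ≤ m → A j ≤ 0) {x : EuclideanSpace ℝ (Fin n)}
    (hx : x ∈ (upperHalfSpace n : Set (EuclideanSpace ℝ (Fin n)))) (hx0 : ∀ i, x i ≠ 0) :
    groundWeight A m x ≤ x 0 ^ (1 - (m - 1) * (1 / n) : ℝ) *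
      (∏ i : Fin n with i.val < m, (1 + |x i| ^ (-(1 - 1 / n) : ℝ))) *
        partialNormSq m x ^ (-A m) := by
  have hx0' : 0 < x 0 := hx
  induction m, hm using Nat.le_induction with
  | base =>
    have h1 : groundWeight A 1 x = x 0 * partialNormSq 1 x ^ (-A 1) := by
      have hP := partialNormSq_pos le_rfl hx
      simp only [groundWeight, Finset.Icc_self, Finset.prod_singleton, hardyExponent]
      rw [Nat.sub_self, hA, show -(A 1 - 1 + 1 / 2) = 1 / 2 + -A 1 by ring, Real.rpow_add hP,
        ← Real.sqrt_eq_rpow, partialNormSq_one, Real.sqrt_sq hx0'.le]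
    have h2 : 1 ≤ ∏ i : Fin n with i.val < 1, (1 + |x i| ^ (-(1 - 1 / n) : ℝ)) := by
      calc (1 : ℝ) = ∏ i : Fin n with i.val < 1, 1 := by simp
        _ ≤ _ := Finset.prod_le_prod (fun _ _ => zero_le_one) fun i _ =>
          le_add_of_nonneg_right (by positivity)
    rw [h1]
    have h3 := Real.rpow_nonneg (partialNormSq_nonneg 1 x) (-A 1)
    simp only [Nat.cast_one, sub_self, zero_mul, sub_zero, Real.rpow_one]
    exact mul_le_mul_of_nonneg_right (le_mul_of_one_le_right hx0'.le h2) h3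
  | succ m hm ih =>
    have ih := ih (by omega) fun j h1 h2 => hA' j h1 (by omega)
    have hP := partialNormSq_pos hm hx
    have hP' := partialNormSq_pos (Nat.le_add_left 1 m) hx
    have hn : (0 : ℝ) < n := by exact_mod_cast (by omega : 0 < n)
    set i₀ : Fin n := ⟨m, hmn⟩ with hi₀
    have hfil : (Finset.univ.filter fun i : Fin n => i.val < m + 1) =
        insert i₀ (Finset.univ.filter fun i : Fin n => i.val < m) := by
      ext i
      simp [Fin.ext_iff, hi₀]
      omega
    have hhalf : partialNormSq (m + 1) x ^ (-(1 / 2) : ℝ) ≤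
        x 0 ^ (-(1 / n) : ℝ) * (1 + |x i₀| ^ (-(1 - 1 / n) : ℝ)) := by
      have e1 : x 0 ^ (-(1 / n) : ℝ) = (x 0 ^ 2) ^ (-(1 / n) / 2 : ℝ) := by
        rw [← Real.rpow_natCast, ← Real.rpow_mul hx0'.le]
        congr 1
        push_cast
        ring
      have e2 : |x i₀| ^ (-(1 - 1 / n) : ℝ) = (x i₀ ^ 2) ^ (-(1 - 1 / n) / 2 : ℝ) := by
        rw [← sq_abs, ← Real.rpow_natCast, ← Real.rpow_mul (abs_nonneg _)]
        congr 1
        push_cast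
        ring
      have hn1 : (1 : ℝ) / n ≤ 1 := by
        rw [div_le_one hn]
        exact_mod_cast (by omega : 1 ≤ n)
      have hn0 : (0 : ℝ) < 1 / n := by positivity
      calc partialNormSq (m + 1) x ^ (-(1 / 2) : ℝ)
          = partialNormSq (m + 1) x ^ (-(1 / n) / 2 : ℝ) *
              partialNormSq (m + 1) x ^ (-(1 - 1 / n) / 2 : ℝ) := by
            rw [← Real.rpow_add hP']
            congr 1
            ring
        _ ≤ (x 0 ^ 2) ^ (-(1 / n) / 2 : ℝ) * (x i₀ ^ 2) ^ (-(1 - 1 / n) / 2 : ℝ) := by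
            refine mul_le_mul ?_ ?_ (Real.rpow_nonneg hP'.le _) (by positivity)
            · exact Real.rpow_le_rpow_of_nonpos (by positivity)
                (sq_apply_le_partialNormSq (by simp) x) (by linarith)
            · exact Real.rpow_le_rpow_of_nonpos (pow_pos (abs_pos.2 (hx0 i₀)) 2 |>.trans_eq
                (sq_abs _)) (sq_apply_le_partialNormSq (by simp [hi₀]) x) (by linarith)
        _ = x 0 ^ (-(1 / n) : ℝ) * |x i₀| ^ (-(1 - 1 / n) : ℝ) := by rw [e1, e2]
        _ ≤ _ := mul_le_mul_of_nonneg_left (by linarith) (by positivity)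
    have hratio : partialNormSq m x ^ (-A m) * partialNormSq (m + 1) x ^ A m ≤ 1 := by
      rw [Real.rpow_neg hP.le, inv_mul_le_one₀ (Real.rpow_pos_of_pos hP _)]
      exact Real.rpow_le_rpow_of_nonpos hP (partialNormSq_mono (Nat.le_succ m) x)
        (hA' m hm (by omega))
    have hsplit : partialNormSq (m + 1) x ^ (-hardyExponent A (m + 1)) =
        partialNormSq (m + 1) x ^ A m * partialNormSq (m + 1) x ^ (-(1 / 2) : ℝ) *
          partialNormSq (m + 1) x ^ (-A (m + 1)) := by
      rw [← Real.rpow_add hP', ← Real.rpow_add hP', hardyExponent]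
      congr 1
      simp only [Nat.add_sub_cancel]
      ring
    have hx0s : x 0 ^ (1 - ((m + 1 : ℕ) - 1) * (1 / n) : ℝ) =
        x 0 ^ (1 - (m - 1) * (1 / n) : ℝ) * x 0 ^ (-(1 / n) : ℝ) := by
      rw [← Real.rpow_add hx0']
      congr 1
      push_cast
      ring
    rw [groundWeight_succ, hsplit, hfil, Finset.prod_insert (by simp [hi₀]), hx0s]
    set Q := ∏ i : Fin n with i.val < m, (1 + |x i| ^ (-(1 - 1 / n) : ℝ)) with hQ
    have hQ0 : 0 ≤ Q := Finset.prod_nonneg fun i _ => by positivity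
    have a1 := Real.rpow_nonneg hP'.le (A m)
    have a2 := Real.rpow_nonneg hP'.le (-(1 / 2))
    have a3 := Real.rpow_nonneg hP'.le (-A (m + 1))
    have a4 : 0 ≤ x 0 ^ (1 - (m - 1) * (1 / n) : ℝ) := by positivity
    calc groundWeight A m x * (partialNormSq (m + 1) x ^ A m *
          partialNormSq (m + 1) x ^ (-(1 / 2) : ℝ) * partialNormSq (m + 1) x ^ (-A (m + 1)))
        ≤ (x 0 ^ (1 - (m - 1) * (1 / n) : ℝ) * Q * partialNormSq m x ^ (-A m)) *
          (partialNormSq (m + 1) x ^ A m * partialNormSq (m + 1) x ^ (-(1 / 2) : ℝ) *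
            partialNormSq (m + 1) x ^ (-A (m + 1))) :=
          mul_le_mul_of_nonneg_right ih (by positivity)
      _ = (partialNormSq m x ^ (-A m) * partialNormSq (m + 1) x ^ A m) *
          (x 0 ^ (1 - (m - 1) * (1 / n) : ℝ) * Q * partialNormSq (m + 1) x ^ (-(1 / 2) : ℝ) *
            partialNormSq (m + 1) x ^ (-A (m + 1))) := by ring
      _ ≤ 1 * (x 0 ^ (1 - (m - 1) * (1 / n) : ℝ) * Q *
          (x 0 ^ (-(1 / n) : ℝ) * (1 + |x i₀| ^ (-(1 - 1 / n) : ℝ))) *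
            partialNormSq (m + 1) x ^ (-A (m + 1))) := by
          refine mul_le_mul hratio ?_ (by positivity) zero_le_one
          exact mul_le_mul_of_nonneg_right (mul_le_mul_of_nonneg_left hhalf (by positivity)) a3
      _ = _ := by ring

lemma integrableOn_abs_rpow {s : ℝ} (hs : -1 < s) {R : ℝ} (hR : 0 ≤ R) :
    IntegrableOn (fun t : ℝ => |t| ^ s) (Icc (-R) R) := by
  have h1 : IntervalIntegrable (fun t : ℝ => |t| ^ s) volume 0 R := by
    refine (intervalIntegral.intervalIntegrable_rpow' hs).congr fun t ht => ?_
    rw [uIoc_of_le hR] at ht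
    rw [abs_of_pos ht.1]
  have h2 : IntervalIntegrable (fun t : ℝ => |t| ^ s) volume (-0) (-R) := by
    rw [IntervalIntegrable.iff_comp_neg]
    simpa using h1
  rw [neg_zero] at h2
  have := h2.symm.trans h1
  rwa [intervalIntegrable_iff_integrableOn_Icc_of_le (by linarith)] at this

lemma lintegral_prod_one_add_abs_rpow_lt_top {s : ℝ} (hs : -1 < s) {R : ℝ} (hR : 0 ≤ R) :
    ∫⁻ x : EuclideanSpace ℝ (Fin n), ENNReal.ofReal
      (∏ i, (Icc (-R) R).indicator (fun t : ℝ => 1 + |t| ^ s) (x i)) < ∞ := by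
  have h : Integrable ((Icc (-R) R).indicator (fun t : ℝ => 1 + |t| ^ s)) := by
    rw [integrable_indicator_iff measurableSet_Icc]
    exact (integrableOn_const (by simp)).add (integrableOn_abs_rpow hs hR)
  have h2 := Integrable.fintype_prod (ι := Fin n) (fun _ => h)
  rw [← volume_pi] at h2
  exact ((PiLp.volume_preserving_ofLp (Fin n)).integrable_comp_of_integrable h2).lintegral_lt_top

lemma ae_apply_ne_zero : ∀ᵐ x : EuclideanSpace ℝ (Fin n), ∀ i, x i ≠ 0 := by
  refine ae_all_iff.2 fun i => ?_
  have h := Measure.ae_eval_ne (fun _ : Fin n => (volume : Measure ℝ)) i 0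
  rw [← volume_pi] at h
  exact (PiLp.volume_preserving_ofLp (Fin n)).quasiMeasurePreserving.ae h

lemma logMeasure_Icc_lt_top [NeZero n] {A : ℕ → ℝ} (hA : A 0 = 1) {m : ℕ} (hm : 1 ≤ m)
    (hmn : m ≤ n) (hA' : ∀ j, 1 ≤ j → j ≤ m → A j ≤ 0) (R T : ℝ) :
    logMeasure n A m R (Icc (-T) T) < ∞ := by
  have hn : (1 : ℝ) ≤ n := by exact_mod_cast hm.trans hmn
  have hn' : (1 : ℝ) / n ≤ 1 := by rw [div_le_one (by linarith)]; exact hn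
  have hn0 : (0 : ℝ) < 1 / n := by positivity
  -- `S` bounds every coordinate: `R` handles those beyond the first `m`, and `x_i² ≤ |X_m|² ≤ e^T`
  -- the others. `S ≥ 1` allows powers of `S` with exponent at most `1` to be replaced by `S`.
  set S := max 1 (max R (Real.exp (T / 2))) with hS
  have hS1 : 1 ≤ S := le_max_left _ _
  rw [← lintegral_indicator_one measurableSet_Icc,
    lintegral_logMeasure A m R (measurable_one.indicator measurableSet_Icc)]
  refine lt_of_le_of_lt (b := ∫⁻ x : EuclideanSpace ℝ (Fin n), ENNReal.ofReal (S * Real.exp T) *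
    ENNReal.ofReal (∏ i, (Icc (-S) S).indicator (fun t : ℝ => 1 + |t| ^ (-(1 - 1 / n) : ℝ)) (x i)))
    (lintegral_mono_ae ?_) ?_
  · filter_upwards [ae_apply_ne_zero (n := n)] with x hx0
    by_cases hc : 0 < x 0 ∧ ∀ i : Fin n, m ≤ i.val → |x i| ≤ R
    swap
    · simp [radialDensity, hc]
    by_cases ht : Real.log (partialNormSq m x) ∈ Icc (-T) T
    swap
    · simp [ht]
    have hx : x ∈ (upperHalfSpace n : Set (EuclideanSpace ℝ (Fin n))) := hc.1
    have hP := partialNormSq_pos hm hx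
    have hxS : ∀ i, |x i| ≤ S := by
      intro i
      by_cases hi : m ≤ i.val
      · exact (hc.2 i hi).trans ((le_max_left _ _).trans (le_max_right _ _))
      · refine le_trans ?_ ((le_max_right _ _).trans (le_max_right _ _))
        refine abs_le_of_sq_le_sq ?_ (Real.exp_pos _).le
        rw [← Real.exp_nat_mul]
        refine (sq_apply_le_partialNormSq (by omega : i.val < m) x).trans ?_
        rw [← Real.log_le_iff_le_exp hP]
        push_cast
        linarith [ht.2]
    have hprod : ∏ i, (Icc (-S) S).indicator (fun t : ℝ => 1 + |t| ^ (-(1 - 1 / n) : ℝ)) (x i) =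
        ∏ i, (1 + |x i| ^ (-(1 - 1 / n) : ℝ)) :=
      Finset.prod_congr rfl fun i _ => indicator_of_mem (mem_Icc.2 (abs_le.1 (hxS i))) _
    rw [hprod, ← ENNReal.ofReal_mul (by positivity), indicator_of_mem ht, Pi.one_apply, mul_one,
      radialDensity, if_pos hc]
    refine ENNReal.ofReal_le_ofReal ?_
    have h1 := groundWeight_le hA hm hmn hA' hx hx0
    have h2 : ∏ i : Fin n with i.val < m, (1 + |x i| ^ (-(1 - 1 / n) : ℝ)) ≤
        ∏ i : Fin n, (1 + |x i| ^ (-(1 - 1 / n) : ℝ)) :=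
      Finset.prod_le_prod_of_subset_of_one_le (Finset.filter_subset _ _)
        (fun i _ => by positivity) fun i _ _ => le_add_of_nonneg_right (by positivity)
    have hQ0 : 0 ≤ ∏ i : Fin n with i.val < m, (1 + |x i| ^ (-(1 - 1 / n) : ℝ)) :=
      Finset.prod_nonneg fun i _ => by positivity
    have h3 : x 0 ^ (1 - (m - 1) * (1 / n) : ℝ) ≤ S := by
      have hm1 : (1 : ℝ) ≤ m := by exact_mod_cast hm
      have hmn' : ((m : ℝ) - 1) * (1 / n) ≤ 1 := by
        rw [mul_one_div, div_le_one (by linarith)]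
        have : (m : ℝ) ≤ n := by exact_mod_cast hmn
        linarith
      calc x 0 ^ (1 - (m - 1) * (1 / n) : ℝ) ≤ S ^ (1 - (m - 1) * (1 / n) : ℝ) :=
            Real.rpow_le_rpow hc.1.le ((le_abs_self _).trans (hxS 0)) (by linarith)
        _ ≤ S ^ (1 : ℝ) := Real.rpow_le_rpow_of_exponent_le hS1
            (by linarith [mul_nonneg (by linarith : (0 : ℝ) ≤ (m : ℝ) - 1) hn0.le])
        _ = S := Real.rpow_one S
    have h4 : partialNormSq m x ^ (-A m) * partialNormSq m x ^ (A m - 1) ≤ Real.exp T := by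
      rw [← Real.rpow_add hP, show -A m + (A m - 1) = -1 by ring, Real.rpow_neg_one,
        inv_le_comm₀ hP (Real.exp_pos _), ← Real.exp_neg, ← Real.le_log_iff_exp_le hP]
      exact ht.1
    have h5 : 0 ≤ partialNormSq m x ^ (A m - 1) := Real.rpow_nonneg hP.le _
    have h6 : 0 ≤ partialNormSq m x ^ (-A m) := Real.rpow_nonneg hP.le _
    calc groundWeight A m x * partialNormSq m x ^ (A m - 1)
        ≤ (x 0 ^ (1 - (m - 1) * (1 / n) : ℝ) *
          (∏ i : Fin n with i.val < m, (1 + |x i| ^ (-(1 - 1 / n) : ℝ))) *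
            partialNormSq m x ^ (-A m)) * partialNormSq m x ^ (A m - 1) :=
          mul_le_mul_of_nonneg_right h1 h5
      _ = x 0 ^ (1 - (m - 1) * (1 / n) : ℝ) *
          (∏ i : Fin n with i.val < m, (1 + |x i| ^ (-(1 - 1 / n) : ℝ))) *
            (partialNormSq m x ^ (-A m) * partialNormSq m x ^ (A m - 1)) := by ring
      _ ≤ S * (∏ i : Fin n, (1 + |x i| ^ (-(1 - 1 / n) : ℝ))) * Real.exp T := by
          gcongr
      _ = _ := by ring
  · rw [lintegral_const_mul' _ _ ENNReal.ofReal_ne_top]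
    exact ENNReal.mul_lt_top ENNReal.ofReal_lt_top
      (lintegral_prod_one_add_abs_rpow_lt_top (by linarith) (by linarith))

/-- In logarithmic scale, integration against `radialDensity` is a multiple of Lebesgue measure. -/
theorem exists_lintegral_radialDensity_eq [NeZero n] {A : ℕ → ℝ} (hA : A 0 = 1) {m : ℕ}
    (hm : 1 ≤ m) (hmn : m ≤ n) (hA' : ∀ j, 1 ≤ j → j ≤ m → A j ≤ 0) {R : ℝ} (hR : 0 < R) :
    ∃ c : NNReal, c ≠ 0 ∧ ∀ G : ℝ → ℝ≥0∞, Measurable G →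
      ∫⁻ x : EuclideanSpace ℝ (Fin n), radialDensity A m R x * G (Real.log (partialNormSq m x)) =
        c * ∫⁻ t, G t := by
  have := isAddLeftInvariant_logMeasure hA hm hmn R
  have hfin : IsFiniteMeasureOnCompacts (logMeasure n A m R) := ⟨fun K hK => by
    obtain ⟨T, hT⟩ := hK.isBounded.subset_closedBall 0
    refine (measure_mono hT).trans_lt ?_
    rw [Real.closedBall_eq_Icc, zero_sub, zero_add]
    exact logMeasure_Icc_lt_top hA hm hmn hA' R T⟩
  -- Uniqueness of Haar measure on `ℝ`.
  have heq := Measure.isAddLeftInvariant_eq_smul (logMeasure n A m R) volume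
  set c := (logMeasure n A m R).addHaarScalarFactor volume with hc
  have key : ∀ G : ℝ → ℝ≥0∞, Measurable G →
      ∫⁻ x : EuclideanSpace ℝ (Fin n), radialDensity A m R x * G (Real.log (partialNormSq m x)) =
        c * ∫⁻ t, G t := by
    intro G hG
    rw [← lintegral_logMeasure A m R hG, heq, lintegral_smul_measure]
    rfl
  refine ⟨c, fun h0 => ?_, key⟩
  -- If `c = 0`, the density would vanish almost everywhere, but it is positive on a nonempty open
  -- set.
  have h1 := key (fun _ => 1) measurable_const
  simp only [h0, mul_one, ENNReal.coe_zero, zero_mul] at h1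
  rw [lintegral_eq_zero_iff (by fun_prop)] at h1
  set U : Set (EuclideanSpace ℝ (Fin n)) := {x | 0 < x 0} ∩ ⋂ i, {x | |x i| < R} with hU
  have hUo : IsOpen U := (upperHalfSpace n).isOpen.inter
    (isOpen_iInter_of_finite fun i => isOpen_lt (by fun_prop) continuous_const)
  have hUne : U.Nonempty := by
    refine ⟨WithLp.toLp 2 fun _ => R / 2, ?_, mem_iInter.2 fun i => ?_⟩
    · change 0 < R / 2
      linarith
    · change |R / 2| < R
      rw [abs_of_pos (by linarith)]
      linarith
  refine (hUo.measure_pos volume hUne).ne' (measure_mono_null (fun x hx => ?_) (ae_iff.1 h1))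
  have hc1 : 0 < x 0 := hx.1
  have hc2 : ∀ i, |x i| < R := fun i => mem_iInter.1 hx.2 i
  change ¬ radialDensity A m R x = 0
  rw [radialDensity, if_pos ⟨hc1, fun i _ => (hc2 i).le⟩]
  exact (ENNReal.ofReal_pos.2 (mul_pos (groundWeight_pos A m hc1)
    (Real.rpow_pos_of_pos (partialNormSq_pos hm hc1) _))).ne'

end LogMeasure

/-! ### Functions of `log |X_m|²` -/

section LogProfile

/-- The function `s ↦ g (log s)` on `(0, ∞)`, extended by zero. -/
noncomputable def logProfile (g : ℝ → ℝ) (s : ℝ) : ℝ := if 0 < s then g (Real.log s) else 0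

lemma logProfile_of_pos (g : ℝ → ℝ) {s : ℝ} (hs : 0 < s) : logProfile g s = g (Real.log s) :=
  if_pos hs

lemma logProfile_eq_zero {g : ℝ → ℝ} {a : ℝ} (ha : ∀ t ≤ a, g t = 0) {s : ℝ}
    (hs : s < Real.exp a) : logProfile g s = 0 := by
  unfold logProfile
  split_ifs with h
  · exact ha _ ((Real.log_lt_iff_lt_exp h).2 hs).le
  · rfl

/-- Vanishing of `g` near `-∞` makes the profile zero on a neighbourhood of `(-∞, 0]`, so the
singularity of `log` is never met. -/
lemma contDiff_logProfile {g : ℝ → ℝ} {k : WithTop ℕ∞} (hg : ContDiff ℝ k g) {a : ℝ}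
    (ha : ∀ t ≤ a, g t = 0) : ContDiff ℝ k (logProfile g) := by
  refine contDiff_iff_contDiffAt.2 fun s => ?_
  rcases lt_or_ge s (Real.exp a) with h | h
  · have : logProfile g =ᶠ[𝓝 s] fun _ => 0 := by
      filter_upwards [Iio_mem_nhds h] with y hy
      exact logProfile_eq_zero ha hy
    exact contDiffAt_const.congr_of_eventuallyEq this
  · have hs := (Real.exp_pos a).trans_le h
    have : logProfile g =ᶠ[𝓝 s] fun y => g (Real.log y) := by
      filter_upwards [Ioi_mem_nhds hs] with y hy
      exact logProfile_of_pos g hy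
    exact (hg.contDiffAt.comp s (Real.contDiffAt_log.2 hs.ne')).congr_of_eventuallyEq this

lemma hasDerivAt_logProfile {g : ℝ → ℝ} (hg : Differentiable ℝ g) {s : ℝ} (hs : 0 < s) :
    HasDerivAt (logProfile g) (deriv g (Real.log s) / s) s := by
  have : logProfile g =ᶠ[𝓝 s] fun y => g (Real.log y) := by
    filter_upwards [Ioi_mem_nhds hs] with y hy
    exact logProfile_of_pos g hy
  have h := (hg (Real.log s)).hasDerivAt.comp s (Real.hasDerivAt_log hs.ne')
  exact HasDerivAt.congr_of_eventuallyEq h this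

variable {n : ℕ}

lemma hasGradientAt_logProfile_partialNormSq {g : ℝ → ℝ} (hg : Differentiable ℝ g) {m : ℕ}
    {x : EuclideanSpace ℝ (Fin n)} (hx : 0 < partialNormSq m x) :
    HasGradientAt (fun x => logProfile g (partialNormSq m x))
      ((deriv g (Real.log (partialNormSq m x)) / partialNormSq m x) • (2 : ℝ) • coordProj m x) x :=
  (hasDerivAt_logProfile hg hx).comp_hasGradientAt' (hasGradientAt_partialNormSq m x)

lemma norm_sq_gradient_logProfile_partialNormSq {g : ℝ → ℝ} (hg : Differentiable ℝ g) {m : ℕ}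
    {x : EuclideanSpace ℝ (Fin n)} (hx : 0 < partialNormSq m x) :
    ‖∇ (fun x => logProfile g (partialNormSq m x)) x‖ ^ 2 =
      4 * deriv g (Real.log (partialNormSq m x)) ^ 2 / partialNormSq m x := by
  rw [(hasGradientAt_logProfile_partialNormSq hg hx).gradient, norm_smul, norm_smul, mul_pow,
    mul_pow, norm_sq_coordProj, Real.norm_eq_abs, Real.norm_eq_abs, sq_abs, sq_abs]
  field_simp
  norm_num

lemma lintegral_comp_mul_add {F : ℝ → ℝ≥0∞} (hF : Measurable F) {c : ℝ} (hc : 0 < c) (b : ℝ) :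
    ∫⁻ t, F (c * t + b) = ENNReal.ofReal c⁻¹ * ∫⁻ t, F t := by
  have h1 : ∫⁻ t, F (c * t + b) = ∫⁻ s, F (s + b) ∂(Measure.map (c * ·) volume) :=
    (lintegral_map (f := fun s => F (s + b)) (by fun_prop) (by fun_prop)).symm
  rw [h1, Real.map_volume_mul_left hc.ne', lintegral_smul_measure, smul_eq_mul,
    abs_of_pos (inv_pos.2 hc), lintegral_add_right_eq_self]

/-- Young's inequality with a free parameter: small `η` keeps the main term almost unchanged in the
cutoff argument. -/
lemma norm_add_sq_le_add_mul {E : Type*} [SeminormedAddCommGroup E] (a b : E) {η : ℝ}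
    (hη : 0 < η) : ‖a + b‖ ^ 2 ≤ (1 + η) * ‖a‖ ^ 2 + (1 + η⁻¹) * ‖b‖ ^ 2 := by
  have h1 : ‖a + b‖ ^ 2 ≤ (‖a‖ + ‖b‖) ^ 2 := by gcongr; exact norm_add_le a b
  have h2 : 0 ≤ η⁻¹ * (η * ‖a‖ - ‖b‖) ^ 2 := by positivity
  have h3 : η⁻¹ * (η * ‖a‖ - ‖b‖) ^ 2 = η * ‖a‖ ^ 2 - 2 * ‖a‖ * ‖b‖ + η⁻¹ * ‖b‖ ^ 2 := by
    field_simp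
    ring
  nlinarith

end LogProfile

/-! ### Weighted energies and a cutoff transverse to `X_M` -/

section WeightedEnergy

variable {n : ℕ}

/-- The weighted Dirichlet energy of `v` for the squared ground state. -/
noncomputable def weightedEnergy [NeZero n] (A : ℕ → ℝ) (M : ℕ) (v : EuclideanSpace ℝ (Fin n) → ℝ) : ℝ≥0∞ :=
  ∫⁻ x in (upperHalfSpace n : Set (EuclideanSpace ℝ (Fin n))),
    ENNReal.ofReal (groundWeight A M x * ‖∇ v x‖ ^ 2)

/-- The weighted Hardy mass of `v` for the squared ground state. -/
noncomputable def weightedMass [NeZero n] (A : ℕ → ℝ) (M : ℕ) (v : EuclideanSpace ℝ (Fin n) → ℝ) : ℝ≥0∞ :=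
  ∫⁻ x in (upperHalfSpace n : Set (EuclideanSpace ℝ (Fin n))),
    ENNReal.ofReal (groundWeight A M x * v x ^ 2 / partialNormSq M x)

lemma exists_transverse_cutoff [NeZero n] (M : ℕ) : ∃ (h : EuclideanSpace ℝ (Fin n) → ℝ) (R C : ℝ),
    0 < R ∧ ContDiff ℝ ((⊤ : ℕ∞) : WithTop ℕ∞) h ∧ (∀ x, h x ∈ Icc (0 : ℝ) 1) ∧
    (∀ x, (∀ i : Fin n, M ≤ i.val → |x i| ≤ 1) → h x = 1) ∧ (∀ x, ‖∇ h x‖ ≤ C) ∧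
    (∀ x ∈ tsupport h, ‖x - coordProj M x‖ ≤ R) := by
  have hn : (1 : ℝ) ≤ n := by exact_mod_cast NeZero.one_le
  -- The cutoff is a bump evaluated at `x - X_M`. Inner radius `n` suffices because `n` coordinates
  -- of size at most `1` have norm at most `√n ≤ n`.
  let b : ContDiffBump (0 : EuclideanSpace ℝ (Fin n)) := ⟨n, n + 1, by linarith, by linarith⟩
  let L : EuclideanSpace ℝ (Fin n) →L[ℝ] EuclideanSpace ℝ (Fin n) :=
    ContinuousLinearMap.id ℝ _ - coordProj M
  have hb : ContDiff ℝ ((⊤ : ℕ∞) : WithTop ℕ∞) b := b.contDiff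
  obtain ⟨C, hC⟩ := (hb.continuous_fderiv (by simp)).bounded_above_of_compact_support
    (b.hasCompactSupport.fderiv ℝ)
  refine ⟨fun x => b (L x), n + 1, C * ‖L‖, by linarith, hb.comp L.contDiff,
    fun x => ⟨b.nonneg, b.le_one⟩, fun x hx => ?_, fun x => ?_, fun x hx => ?_⟩
  · refine b.one_of_mem_closedBall ?_
    rw [mem_closedBall_zero_iff]
    change ‖L x‖ ≤ n
    refine abs_le_of_sq_le_sq ?_ (by linarith) |>.trans' (le_abs_self _)
    rw [EuclideanSpace.norm_sq_eq]
    calc ∑ i, ‖L x i‖ ^ 2 ≤ ∑ i : Fin n, (1 : ℝ) := by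
          refine Finset.sum_le_sum fun i _ => ?_
          have hLi : L x i = if i.val < M then 0 else x i := by
            change x i - coordProj M x i = _
            rw [coordProj_apply]
            split_ifs <;> simp
          rw [hLi]
          split_ifs with h
          · simp
          · rw [Real.norm_eq_abs, sq_abs]
            exact (sq_le_one_iff_abs_le_one _).2 (hx i (by omega))
      _ = n := by simp
      _ ≤ (n : ℝ) ^ 2 := by nlinarith
  · have h1 : fderiv ℝ (fun x => b (L x)) x = (fderiv ℝ b (L x)).comp L := by
      have := ((hb.differentiable (by simp)) (L x)).hasFDerivAt.comp x L.hasFDerivAt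
      exact this.fderiv
    rw [gradient, LinearIsometryEquiv.norm_map, h1]
    exact (ContinuousLinearMap.opNorm_comp_le _ _).trans
      (mul_le_mul_of_nonneg_right (hC _) (norm_nonneg _))
  · have h2 := tsupport_comp_subset_preimage (b : EuclideanSpace ℝ (Fin n) → ℝ) L.continuous hx
    rw [mem_preimage, b.tsupport_eq, mem_closedBall_zero_iff] at h2
    exact h2

lemma abs_apply_le_norm_sub_coordProj {M : ℕ} {i : Fin n} (hi : M ≤ i.val)
    (x : EuclideanSpace ℝ (Fin n)) : |x i| ≤ ‖x - coordProj M x‖ := by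
  have := PiLp.norm_apply_le (x - coordProj M x) i
  simpa [coordProj_apply, not_lt.2 hi] using this

end WeightedEnergy

open Metric

/-! ### Trial functions concentrating at `X_M = 0` -/

section Trial

variable {n : ℕ} [NeZero n]

/-- Smooth functions with compact support away from `{|X_m| = 0}`. -/
structure IsTrial (m : ℕ) (v : EuclideanSpace ℝ (Fin n) → ℝ) : Prop where
  contDiff : ContDiff ℝ ((⊤ : ℕ∞) : WithTop ℕ∞) v
  hasCompactSupport : HasCompactSupport v
  tsupport_subset : tsupport v ⊆ {x | partialNormSq m x ≠ 0}

lemma radialDensity_of_mem {A : ℕ → ℝ} {m : ℕ} {R : ℝ} {x : EuclideanSpace ℝ (Fin n)}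
    (hx : x ∈ (upperHalfSpace n : Set (EuclideanSpace ℝ (Fin n))))
    (hR : ∀ i : Fin n, m ≤ i.val → |x i| ≤ R) :
    radialDensity A m R x = ENNReal.ofReal (groundWeight A m x * partialNormSq m x ^ (A m - 1)) :=
  if_pos ⟨hx, hR⟩

/-- Trial functions concentrating at `X_M = 0` in logarithmic scale: when `A M = 0`, the ground
state is critical. -/
theorem exists_isTrial_weightedEnergy_lt {A : ℕ → ℝ} (hA : A 0 = 1) {M : ℕ} (hM : 1 ≤ M)
    (hMn : M ≤ n) (hA' : ∀ j, 1 ≤ j → j ≤ M → A j ≤ 0) (hAM : A M = 0) {κ : ℝ≥0∞} (hκ : κ ≠ ∞) :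
    ∃ v : EuclideanSpace ℝ (Fin n) → ℝ, IsTrial M v ∧
      κ * weightedEnergy A M v < weightedMass A M v := by
  obtain ⟨h, R, C, hR, hh, hh01, hh1, hhC, hhs⟩ := exists_transverse_cutoff (n := n) M
  obtain ⟨c₁, hc₁, key₁⟩ := exists_lintegral_radialDensity_eq hA hM hMn hA' one_pos
  obtain ⟨c₂, -, key₂⟩ := exists_lintegral_radialDensity_eq hA hM hMn hA' hR
  let b : ContDiffBump (0 : ℝ) := ⟨1 / 2, 1, by norm_num, by norm_num⟩
  have hb : ContDiff ℝ ((⊤ : ℕ∞) : WithTop ℕ∞) b := b.contDiff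
  have hbd : Continuous (deriv b) := hb.continuous_deriv (by simp)
  set I : ℝ≥0∞ := ∫⁻ t, ENNReal.ofReal (b t ^ 2) with hI
  set J : ℝ≥0∞ := ∫⁻ t, ENNReal.ofReal (8 * deriv b t ^ 2 + 2 * C ^ 2 * b t ^ 2) with hJ
  have hI0 : I ≠ 0 := by
    intro h0
    rw [hI, lintegral_eq_zero_iff (by have := hb.continuous; fun_prop)] at h0
    refine (isOpen_ball.measure_pos volume ⟨(0 : ℝ), mem_ball_self one_pos⟩).ne'
      (measure_mono_null (fun x hx => ?_) (ae_iff.1 h0))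
    change ¬ ENNReal.ofReal (b x ^ 2) = 0
    exact (ENNReal.ofReal_pos.2 (pow_pos (b.pos_of_mem_ball hx) 2)).ne'
  have hJt : J ≠ ∞ := by
    refine (Integrable.lintegral_lt_top (Continuous.integrable_of_hasCompactSupport
      (by have := hb.continuous; fun_prop) ?_)).ne
    refine b.hasCompactSupport.mono' fun t ht => ?_
    by_contra h0
    refine ht ?_
    have h1 : deriv b t = 0 := by
      have := (notMem_tsupport_iff_eventuallyEq.1 h0).deriv_eq
      simpa using this
    simp [h1, image_eq_zero_of_notMem_tsupport h0]
  -- The energy will be at most `c₂ J` for every scale `k`, while the mass is at least `k c₁ I`;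
  -- this `k` makes the mass win.
  obtain ⟨k, hk⟩ := ENNReal.exists_nat_mul_gt (a := c₁ * I) (b := κ * (c₂ * J))
    (mul_ne_zero (by simpa using hc₁) hI0)
    (ENNReal.mul_ne_top hκ (ENNReal.mul_ne_top ENNReal.coe_ne_top hJt))
  have hk0 : k ≠ 0 := by
    rintro rfl
    simp at hk
  have hkpos : (0 : ℝ) < k := by exact_mod_cast Nat.pos_of_ne_zero hk0
  have hk1 : (1 : ℝ) ≤ k := by exact_mod_cast Nat.pos_of_ne_zero hk0
  set l : ℝ := (k : ℝ)⁻¹ with hl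
  have hlpos : 0 < l := inv_pos.2 hkpos
  have hl1 : l ≤ 1 := inv_le_one_of_one_le₀ hk1
  -- The profile has width of order `k` and lives on `(-3k, -k)`. The width makes its derivative of
  -- size `1/k`; the shift by `2` forces `|X_M|² ≤ e^(-k)`, which tames the gradient of the
  -- transverse cutoff `h`.
  set g : ℝ → ℝ := fun t => b (l * t + 2) with hg
  have hgs : ContDiff ℝ ((⊤ : ℕ∞) : WithTop ℕ∞) g := hb.comp (by fun_prop)
  have hgd : ∀ t, deriv g t = l * deriv b (l * t + 2) := by
    intro t
    have h1 : HasDerivAt (fun t : ℝ => l * t + 2) l t := by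
      simpa using ((hasDerivAt_id t).const_mul l).add_const 2
    have h2 := ((hb.differentiable (by simp)) (l * t + 2)).hasDerivAt.comp t h1
    rw [mul_comm]
    exact h2.deriv
  have hg0 : ∀ t, g t ≠ 0 → -(3 * k) < t ∧ t < -k := by
    intro t ht
    have h1 : l * t + 2 ∈ Function.support b := ht
    rw [b.support_eq, mem_ball_zero_iff, Real.norm_eq_abs, abs_lt] at h1
    have h2 : k * l = 1 := mul_inv_cancel₀ hkpos.ne'
    have h3 : (k : ℝ) * (l * t) = t := by rw [← mul_assoc, h2, one_mul]
    have h4 := mul_lt_mul_of_pos_left h1.1 hkpos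
    have h5 := mul_lt_mul_of_pos_left h1.2 hkpos
    constructor <;> nlinarith
  have hga : ∀ t ≤ -(3 * k : ℝ), g t = 0 := by
    intro t ht
    by_contra h0
    linarith [(hg0 t h0).1]
  set v : EuclideanSpace ℝ (Fin n) → ℝ := fun x => logProfile g (partialNormSq M x) * h x with hv
  have hGs : ContDiff ℝ ((⊤ : ℕ∞) : WithTop ℕ∞)
      fun x : EuclideanSpace ℝ (Fin n) => logProfile g (partialNormSq M x) :=
    (contDiff_logProfile hgs hga).comp (contDiff_partialNormSq M)
  have hvsupp : ∀ x, v x ≠ 0 → Real.exp (-(3 * k)) ≤ partialNormSq M x ∧ partialNormSq M x ≤ 1 ∧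
      x ∈ tsupport h := by
    intro x hx
    have h1 : logProfile g (partialNormSq M x) ≠ 0 := left_ne_zero_of_mul hx
    have h2 : h x ≠ 0 := right_ne_zero_of_mul hx
    have h3 : Real.exp (-(3 * k)) ≤ partialNormSq M x := by
      by_contra h4
      exact h1 (logProfile_eq_zero hga (not_le.1 h4))
    have hP := (Real.exp_pos _).trans_le h3
    rw [logProfile_of_pos g hP] at h1
    refine ⟨h3, ?_, subset_tsupport _ h2⟩
    rw [← Real.log_nonpos_iff hP.le]
    linarith [(hg0 _ h1).2]
  refine ⟨v, ⟨hGs.mul hh, ?_, ?_⟩, ?_⟩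
  · refine HasCompactSupport.of_support_subset_isCompact (isCompact_closedBall 0 (1 + R))
      fun x hx => ?_
    obtain ⟨-, h2, h3⟩ := hvsupp x hx
    rw [mem_closedBall_zero_iff]
    have h4 : ‖coordProj M x‖ ≤ 1 := by
      rw [← norm_sq_coordProj] at h2
      exact (sq_le_one_iff₀ (norm_nonneg _)).1 h2
    calc ‖x‖ = ‖coordProj M x + (x - coordProj M x)‖ := by rw [add_sub_cancel]
      _ ≤ _ := (norm_add_le _ _).trans (add_le_add h4 (hhs x h3))
  · have hcl : IsClosed {x : EuclideanSpace ℝ (Fin n) | Real.exp (-(3 * k)) ≤ partialNormSq M x} :=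
      isClosed_le continuous_const (by fun_prop)
    refine (closure_minimal (fun x hx => (hvsupp x hx).1) hcl).trans fun x hx => ?_
    exact ((Real.exp_pos _).trans_le hx).ne'
  · have hN : weightedEnergy A M v ≤ c₂ * J := by
      calc weightedEnergy A M v
          ≤ ∫⁻ x : EuclideanSpace ℝ (Fin n), radialDensity A M R x *
            (fun t => ENNReal.ofReal (l * (8 * deriv b (l * t + 2) ^ 2 +
              2 * C ^ 2 * b (l * t + 2) ^ 2))) (Real.log (partialNormSq M x)) := by
            refine (setLIntegral_mono' (upperHalfSpace n).isOpen.measurableSet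
              fun x hx => ?_).trans (setLIntegral_le_lintegral _ _)
            have hP := partialNormSq_pos hM hx
            by_cases hxs : x ∈ tsupport h
            swap
            · have : x ∉ tsupport v := fun hx' => hxs
                (closure_mono (t := Function.support h) (fun y hy => right_ne_zero_of_mul (Function.mem_support.1 hy)) hx')
              simp [gradient_eq_zero_of_notMem_tsupport this]
            rw [radialDensity_of_mem hx fun i hi =>
              (abs_apply_le_norm_sub_coordProj hi x).trans (hhs x hxs),
              ← ENNReal.ofReal_mul (mul_nonneg (groundWeight_nonneg A M x)
                (Real.rpow_nonneg hP.le _)), mul_assoc]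
            refine ENNReal.ofReal_le_ofReal
              (mul_le_mul_of_nonneg_left ?_ (groundWeight_nonneg A M x))
            have hgrad := ((hGs.differentiable (by simp)) x).hasGradientAt.mul'
              ((hh.differentiable (by simp)) x).hasGradientAt
            have hG := norm_sq_gradient_logProfile_partialNormSq
              (hgs.differentiable (by simp)) hP
            set t := Real.log (partialNormSq M x) with ht
            have hGx : logProfile g (partialNormSq M x) = b (l * t + 2) := logProfile_of_pos g hP
            have e1 : ‖∇ v x‖ ^ 2 ≤ 2 * (b (l * t + 2) ^ 2 * C ^ 2) +
                2 * (4 * (l * deriv b (l * t + 2)) ^ 2 / partialNormSq M x) := by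
              rw [show ∇ v x = _ from hgrad.gradient]
              refine (norm_add_sq_le_add_mul _ _ one_pos).trans ?_
              rw [norm_smul, norm_smul, mul_pow, mul_pow, hG, hgd, hGx, Real.norm_eq_abs,
                Real.norm_eq_abs, sq_abs, sq_abs, inv_one, one_add_one_eq_two]
              have h1 : ‖∇ h x‖ ^ 2 ≤ C ^ 2 := pow_le_pow_left₀ (norm_nonneg _) (hhC x) 2
              have h2 : h x ^ 2 ≤ 1 := pow_le_one₀ (hh01 x).1 (hh01 x).2
              have h3 : 0 ≤ 4 * (l * deriv b (l * t + 2)) ^ 2 / partialNormSq M x := by positivity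
              have h4 := mul_le_mul_of_nonneg_left h1 (sq_nonneg (b (l * t + 2)))
              have h5 := mul_le_mul_of_nonneg_right h2 h3
              linarith
            -- Where `b` does not vanish, `|X_M|² = e^t ≤ e^(-k) ≤ 1/k = l`.
            have e2 : b (l * t + 2) ^ 2 * partialNormSq M x ≤ l * b (l * t + 2) ^ 2 := by
              by_cases hb0 : b (l * t + 2) = 0
              · simp [hb0]
              · have h1 := (hg0 t hb0).2
                rw [mul_comm]
                refine mul_le_mul_of_nonneg_right ?_ (sq_nonneg _)
                calc partialNormSq M x = Real.exp t := (Real.exp_log hP).symm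
                  _ ≤ Real.exp (-k) := Real.exp_le_exp.2 h1.le
                  _ = (Real.exp k)⁻¹ := Real.exp_neg _
                  _ ≤ (k : ℝ)⁻¹ := inv_anti₀ hkpos (by linarith [Real.add_one_le_exp (k : ℝ)])
            have e3 : l ^ 2 ≤ l := by nlinarith
            refine e1.trans ?_
            rw [hAM, zero_sub, Real.rpow_neg_one, inv_mul_eq_div (partialNormSq M x), le_div_iff₀ hP, add_mul]
            have h6 : 2 * (4 * (l * deriv b (l * t + 2)) ^ 2 / partialNormSq M x) *
                partialNormSq M x = 8 * l ^ 2 * deriv b (l * t + 2) ^ 2 := by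
              field_simp
              ring
            rw [h6]
            have h7 := mul_le_mul_of_nonneg_left e2 (sq_nonneg C)
            have h8 := mul_le_mul_of_nonneg_right e3 (sq_nonneg (deriv b (l * t + 2)))
            nlinarith
        _ = c₂ * ∫⁻ t, ENNReal.ofReal (l * (8 * deriv b (l * t + 2) ^ 2 +
              2 * C ^ 2 * b (l * t + 2) ^ 2)) :=
            key₂ (fun t => ENNReal.ofReal (l * (8 * deriv b (l * t + 2) ^ 2 +
              2 * C ^ 2 * b (l * t + 2) ^ 2))) (by have := hb.continuous; fun_prop)
        _ = c₂ * J := by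
            congr 1
            simp_rw [ENNReal.ofReal_mul hlpos.le]
            rw [lintegral_const_mul _ (by have := hb.continuous; fun_prop),
              lintegral_comp_mul_add (F := fun t => ENNReal.ofReal
                (8 * deriv b t ^ 2 + 2 * C ^ 2 * b t ^ 2))
                (by have := hb.continuous; fun_prop) hlpos, ← mul_assoc,
              ← ENNReal.ofReal_mul hlpos.le, mul_inv_cancel₀ hlpos.ne', ENNReal.ofReal_one, one_mul]
    have hD : k * (c₁ * I) ≤ weightedMass A M v := by
      calc k * (c₁ * I) = c₁ * ∫⁻ t, ENNReal.ofReal (b (l * t + 2) ^ 2) := by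
            rw [lintegral_comp_mul_add (F := fun t => ENNReal.ofReal (b t ^ 2))
              (by have := hb.continuous; fun_prop) hlpos, hl, inv_inv, ENNReal.ofReal_natCast,
              mul_left_comm]
        _ = ∫⁻ x : EuclideanSpace ℝ (Fin n), radialDensity A M 1 x *
            (fun t => ENNReal.ofReal (b (l * t + 2) ^ 2)) (Real.log (partialNormSq M x)) :=
            (key₁ (fun t => ENNReal.ofReal (b (l * t + 2) ^ 2))
              (by have := hb.continuous; fun_prop)).symm
        _ ≤ weightedMass A M v := by
            rw [weightedMass, ← lintegral_indicator (upperHalfSpace n).isOpen.measurableSet]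
            refine lintegral_mono fun x => ?_
            by_cases hc : 0 < x 0 ∧ ∀ i : Fin n, M ≤ i.val → |x i| ≤ 1
            swap
            · simp [radialDensity, hc]
            have hx : x ∈ (upperHalfSpace n : Set (EuclideanSpace ℝ (Fin n))) := hc.1
            have hP := partialNormSq_pos hM hx
            rw [indicator_of_mem hx, radialDensity_of_mem hx hc.2,
              ← ENNReal.ofReal_mul (mul_nonneg (groundWeight_nonneg A M x)
                (Real.rpow_nonneg hP.le _))]
            refine ENNReal.ofReal_le_ofReal (le_of_eq ?_)
            have hGx : logProfile g (partialNormSq M x) = b (l * Real.log (partialNormSq M x) + 2) :=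
              logProfile_of_pos g hP
            simp only [hv, hh1 x hc.2, mul_one, hGx, hAM, zero_sub, Real.rpow_neg_one]
            ring
    exact (mul_le_mul_right hN κ).trans_lt (hk.trans_le hD)

end Trial

/-! ### Removing a neighbourhood of `X_m = 0` -/

section Cutoff

variable {n : ℕ}

lemma groundWeight_eq_mul_prod_Ioc (A : ℕ → ℝ) {m M : ℕ} (hmM : m ≤ M)
    (x : EuclideanSpace ℝ (Fin n)) :
    groundWeight A M x = groundWeight A m x *
      ∏ j ∈ Finset.Ioc m M, partialNormSq j x ^ (-hardyExponent A j) := by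
  induction M, hmM using Nat.le_induction with
  | base => simp
  | succ M hM ih =>
    rw [groundWeight_succ, ih, ← Finset.insert_Ioc_right_eq_Ioc_add_one hM, Finset.prod_insert
      (by simp)]
    ring

/-- A trial function can be cut off near `{|X_m| = 0}` at an arbitrarily small cost. -/
theorem IsTrial.exists_cutoff [NeZero n] {A : ℕ → ℝ} (hA : A 0 = 1) {m M : ℕ} (hm : 1 ≤ m) (hmM : m < M)
    (hMn : M ≤ n) (hA' : ∀ j, 1 ≤ j → j ≤ M → A j ≤ 0) {κ : ℝ≥0∞} (hκ0 : κ ≠ 0) (hκ : κ ≠ ∞)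
    {v : EuclideanSpace ℝ (Fin n) → ℝ} (hv : IsTrial (m + 1) v)
    (hlt : κ * weightedEnergy A M v < weightedMass A M v) :
    ∃ v' : EuclideanSpace ℝ (Fin n) → ℝ, IsTrial m v' ∧
      κ * weightedEnergy A M v' < weightedMass A M v' := by
  have hΩm := (upperHalfSpace n).isOpen.measurableSet
  have hM : 1 ≤ M := by omega
  obtain ⟨hvd, hvc, hvs⟩ := hv
  obtain ⟨R, hR, hKR⟩ : ∃ R : ℝ, 0 < R ∧ tsupport v ⊆ closedBall 0 R := by
    obtain ⟨R, hR⟩ := hvc.isCompact.isBounded.subset_closedBall 0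
    exact ⟨max R 1, by positivity, hR.trans (closedBall_subset_closedBall (le_max_left _ _))⟩
  -- `C` bounds what remains of `4 φ² v² / |X_m|²` after extracting the density `φ_m² |X_m|^(2 A_m -
  -- 2)`. The factors with `j > m` are continuous because `X_{m+1} ≠ 0` on the support of `v`, and
  -- `|X_m|^(-2 A_m)` is continuous because `A_m ≤ 0`.
  obtain ⟨C, hC⟩ : ∃ C : ℝ, ∀ x ∈ tsupport v,
      ‖4 * v x ^ 2 * (∏ j ∈ Finset.Ioc m M, partialNormSq j x ^ (-hardyExponent A j)) *
        partialNormSq m x ^ (-A m)‖ ≤ C := by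
    refine hvc.isCompact.exists_bound_of_continuousOn ?_
    refine ContinuousOn.mul (ContinuousOn.mul (by have := hvd.continuous; fun_prop)
      (continuousOn_finsetProd _ fun j hj => ?_)) ?_
    · refine ContinuousOn.rpow_const (by fun_prop) fun x hx => Or.inl ?_
      have h1 : 0 < partialNormSq (m + 1) x :=
        (partialNormSq_nonneg _ x).lt_of_ne' (hvs hx)
      exact (h1.trans_le (partialNormSq_mono (Finset.mem_Ioc.1 hj).1 x)).ne'
    · exact ContinuousOn.rpow_const (by fun_prop)
        fun x _ => Or.inr (neg_nonneg.2 (hA' m hm hmM.le))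
  obtain ⟨c, -, key⟩ := exists_lintegral_radialDensity_eq hA hm (hmM.le.trans hMn)
    (fun j h1 h2 => hA' j h1 (h2.trans hmM.le)) hR
  set χ : ℝ → ℝ := fun t => Real.smoothTransition (t + 2) with hχ
  have hχs : ContDiff ℝ ((⊤ : ℕ∞) : WithTop ℕ∞) χ :=
    Real.smoothTransition.contDiff.comp (by fun_prop)
  have hχd : Continuous (deriv χ) := hχs.continuous_deriv (by simp)
  have hχ0 : ∀ t ≤ -2, χ t = 0 := fun t ht => Real.smoothTransition.zero_of_nonpos (by linarith)
  have hχ1 : ∀ t, -1 ≤ t → χ t = 1 := fun t ht => Real.smoothTransition.one_of_one_le (by linarith)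
  set J : ℝ≥0∞ := ∫⁻ t, ENNReal.ofReal (deriv χ t ^ 2) with hJ
  have hJt : J ≠ ∞ := by
    refine (Integrable.lintegral_lt_top (Continuous.integrable_of_hasCompactSupport
      (by fun_prop) ?_)).ne
    refine HasCompactSupport.of_support_subset_isCompact (isCompact_Icc (a := -2) (b := -1))
      fun t ht => ?_
    by_contra h0
    refine ht ?_
    have h1 : deriv χ t = 0 := by
      rcases lt_or_ge t (-2) with h | h
      · have : χ =ᶠ[𝓝 t] fun _ => 0 := by
          filter_upwards [Iio_mem_nhds h] with y hy
          exact hχ0 y (le_of_lt hy)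
        simpa using this.deriv_eq
      · have h2 : -1 < t := by
          by_contra h2
          exact h0 ⟨h, not_lt.1 h2⟩
        have : χ =ᶠ[𝓝 t] fun _ => 1 := by
          filter_upwards [Ioi_mem_nhds h2] with y hy
          exact hχ1 y (le_of_lt hy)
        simpa using this.deriv_eq
    simp [h1]
  -- The cutoff scale is `η²` while Young's parameter is `η`. The squared derivative gives `η⁴`, the
  -- change of variables `η⁻²`, and Young's inequality `1 + η⁻¹`, so the cost is of order `η² + η`.
  set w : ℝ → EuclideanSpace ℝ (Fin n) → ℝ := fun η x =>
    v x * logProfile (fun t => χ (η ^ 2 * t)) (partialNormSq m x) with hw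
  have hgs : ∀ η : ℝ, ContDiff ℝ ((⊤ : ℕ∞) : WithTop ℕ∞) fun t => χ (η ^ 2 * t) :=
    fun η => hχs.comp (by fun_prop)
  have hga : ∀ η : ℝ, 0 < η → ∀ t ≤ -2 / η ^ 2, χ (η ^ 2 * t) = 0 := by
    intro η hη t ht
    rw [le_div_iff₀ (by positivity)] at ht
    exact hχ0 _ (by linarith)
  have hgd : ∀ η t : ℝ, deriv (fun t => χ (η ^ 2 * t)) t = η ^ 2 * deriv χ (η ^ 2 * t) := by
    intro η t
    have h1 : HasDerivAt (fun t : ℝ => η ^ 2 * t) (η ^ 2) t := by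
      simpa using (hasDerivAt_id t).const_mul (η ^ 2)
    have h2 := ((hχs.differentiable (by simp)) (η ^ 2 * t)).hasDerivAt.comp t h1
    rw [mul_comm (η ^ 2)]
    exact h2.deriv
  have hGs : ∀ η : ℝ, 0 < η → ContDiff ℝ ((⊤ : ℕ∞) : WithTop ℕ∞)
      fun x : EuclideanSpace ℝ (Fin n) =>
        logProfile (fun t => χ (η ^ 2 * t)) (partialNormSq m x) := fun η hη =>
    (contDiff_logProfile (hgs η) (hga η hη)).comp (contDiff_partialNormSq m)
  have htrial : ∀ η : ℝ, 0 < η → IsTrial m (w η) := by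
    intro η hη
    refine ⟨hvd.mul (hGs η hη), hvc.mul_right, ?_⟩
    have hcl : IsClosed {x : EuclideanSpace ℝ (Fin n) |
        Real.exp (-2 / η ^ 2) ≤ partialNormSq m x} := isClosed_le continuous_const (by fun_prop)
    refine (closure_minimal (fun x hx => ?_) hcl).trans fun x hx => ?_
    · by_contra h4
      exact right_ne_zero_of_mul (Function.mem_support.1 hx)
        (logProfile_eq_zero (hga η hη) (not_le.1 h4))
    · exact ((Real.exp_pos _).trans_le hx).ne'
  have henergy : ∀ η : ℝ, 0 < η → weightedEnergy A M (w η) ≤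
      ENNReal.ofReal (1 + η) * weightedEnergy A M v +
        ENNReal.ofReal (C * (η ^ 2 + η)) * (c * J) := by
    intro η hη
    have hη2 : 0 < η ^ 2 := by positivity
    have hmeas : Measurable fun t => ENNReal.ofReal (deriv χ (η ^ 2 * t) ^ 2) := by fun_prop
    calc weightedEnergy A M (w η)
        ≤ ∫⁻ x in (upperHalfSpace n : Set (EuclideanSpace ℝ (Fin n))),
            (ENNReal.ofReal (1 + η) * ENNReal.ofReal (groundWeight A M x * ‖∇ v x‖ ^ 2) +
              ENNReal.ofReal ((1 + η⁻¹) * C * η ^ 4) * (radialDensity A m R x *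
                ENNReal.ofReal (deriv χ (η ^ 2 * Real.log (partialNormSq m x)) ^ 2))) := by
          refine setLIntegral_mono' hΩm fun x hx => ?_
          have hP := partialNormSq_pos hm hx
          have hW := groundWeight_nonneg A M x
          by_cases hxs : x ∈ tsupport v
          swap
          · have : x ∉ tsupport (w η) := fun hx' => hxs (closure_mono (t := Function.support v)
              (fun y hy => left_ne_zero_of_mul (Function.mem_support.1 hy)) hx')
            simp [gradient_eq_zero_of_notMem_tsupport this]
          have hC0 : 0 ≤ C := (norm_nonneg _).trans (hC x hxs)
          have hgrad := ((hvd.differentiable (by simp)) x).hasGradientAt.mul'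
            (((hGs η hη).differentiable (by simp)) x).hasGradientAt
          have hG := norm_sq_gradient_logProfile_partialNormSq
            ((hgs η).differentiable (by simp)) hP
          rw [hgd] at hG
          have hF := (le_abs_self _).trans (hC x hxs)
          rw [radialDensity_of_mem hx fun i _ => (PiLp.norm_apply_le x i).trans
              (mem_closedBall_zero_iff.1 (hKR hxs)),
            ← ENNReal.ofReal_mul (by positivity),
            ← ENNReal.ofReal_mul (mul_nonneg (groundWeight_nonneg A m x)
              (Real.rpow_nonneg hP.le _)),
            ← ENNReal.ofReal_mul (by positivity), ← ENNReal.ofReal_add (by positivity)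
              (mul_nonneg (by positivity) (mul_nonneg (mul_nonneg (groundWeight_nonneg A m x)
              (Real.rpow_nonneg hP.le _)) (sq_nonneg _)))]
          refine ENNReal.ofReal_le_ofReal ?_
          set t := Real.log (partialNormSq m x) with ht
          set G := logProfile (fun t => χ (η ^ 2 * t)) (partialNormSq m x) with hGdef
          have hG1 : G ^ 2 ≤ 1 := by
            rw [hGdef, logProfile_of_pos _ hP]
            exact pow_le_one₀ (Real.smoothTransition.nonneg _) (Real.smoothTransition.le_one _)
          have e1 : ‖∇ (w η) x‖ ^ 2 ≤ (1 + η) * ‖∇ v x‖ ^ 2 + (1 + η⁻¹) *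
              (v x ^ 2 * (4 * (η ^ 2 * deriv χ (η ^ 2 * t)) ^ 2 / partialNormSq m x)) := by
            rw [show ∇ (w η) x = _ from hgrad.gradient, add_comm (v x • _)]
            refine (norm_add_sq_le_add_mul _ _ hη).trans ?_
            rw [norm_smul, norm_smul, mul_pow, mul_pow, hG, Real.norm_eq_abs, Real.norm_eq_abs,
              sq_abs, sq_abs]
            have := mul_le_mul_of_nonneg_right hG1 (sq_nonneg ‖∇ v x‖)
            rw [one_mul] at this
            gcongr
          have e2 : groundWeight A M x *
              (v x ^ 2 * (4 * (η ^ 2 * deriv χ (η ^ 2 * t)) ^ 2 / partialNormSq m x)) ≤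
              C * η ^ 4 * (groundWeight A m x * partialNormSq m x ^ (A m - 1) *
                deriv χ (η ^ 2 * t) ^ 2) := by
            have h1 : partialNormSq m x ^ (-A m) * partialNormSq m x ^ (A m - 1) =
                (partialNormSq m x)⁻¹ := by
              rw [← Real.rpow_add hP, show -A m + (A m - 1) = -1 by ring, Real.rpow_neg_one]
            have h2 : 0 ≤ η ^ 4 * (groundWeight A m x * partialNormSq m x ^ (A m - 1) *
                deriv χ (η ^ 2 * t) ^ 2) :=
              mul_nonneg (by positivity) (mul_nonneg (mul_nonneg (groundWeight_nonneg A m x)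
                (Real.rpow_nonneg hP.le _)) (sq_nonneg _))
            refine le_of_eq_of_le ?_ ((mul_le_mul_of_nonneg_right hF h2).trans_eq (by ring))
            rw [groundWeight_eq_mul_prod_Ioc A hmM.le, div_eq_mul_inv, ← h1]
            ring
          have e3 := mul_le_mul_of_nonneg_left e2 (by positivity : 0 ≤ 1 + η⁻¹)
          have e4 := mul_le_mul_of_nonneg_left e1 hW
          refine e4.trans ?_
          linarith
      _ = ENNReal.ofReal (1 + η) * weightedEnergy A M v +
            ENNReal.ofReal ((1 + η⁻¹) * C * η ^ 4) *
              ∫⁻ x in (upperHalfSpace n : Set (EuclideanSpace ℝ (Fin n))), radialDensity A m R x *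
                ENNReal.ofReal (deriv χ (η ^ 2 * Real.log (partialNormSq m x)) ^ 2) := by
          rw [lintegral_add_right _ (by fun_prop), lintegral_const_mul' _ _ ENNReal.ofReal_ne_top,
            lintegral_const_mul' _ _ ENNReal.ofReal_ne_top, weightedEnergy]
      _ ≤ ENNReal.ofReal (1 + η) * weightedEnergy A M v +
            ENNReal.ofReal ((1 + η⁻¹) * C * η ^ 4) *
              (c * ∫⁻ t, ENNReal.ofReal (deriv χ (η ^ 2 * t) ^ 2)) := by
          gcongr
          rw [← key _ hmeas]
          exact setLIntegral_le_lintegral _ _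
      _ = _ := by
          have h1 := lintegral_comp_mul_add (F := fun t => ENNReal.ofReal (deriv χ t ^ 2))
            (by fun_prop) hη2 0
          simp only [add_zero] at h1
          rw [h1, mul_left_comm (c : ℝ≥0∞), ← mul_assoc, ← ENNReal.ofReal_mul' (by positivity)]
          congr 3
          field_simp
  by_contra! hcon
  have hbound : ∀ k : ℕ, weightedMass A M (w (1 / ((k : ℝ) + 1))) ≤ κ *
      (ENNReal.ofReal (1 + 1 / ((k : ℝ) + 1)) * weightedEnergy A M v +
        ENNReal.ofReal (C * ((1 / ((k : ℝ) + 1)) ^ 2 + 1 / ((k : ℝ) + 1))) * (c * J)) :=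
    fun k => (hcon _ (htrial _ Nat.one_div_pos_of_nat)).trans
      (mul_le_mul_right (henergy _ Nat.one_div_pos_of_nat) κ)
  have hη : Tendsto (fun k : ℕ => 1 / ((k : ℝ) + 1)) atTop (𝓝 0) :=
    tendsto_one_div_add_atTop_nhds_zero_nat
  -- Strictness of the hypothesis with `κ ≠ 0` excludes infinite energy.
  have hNfin : weightedEnergy A M v ≠ ∞ := by
    intro h
    rw [h, ENNReal.mul_top hκ0] at hlt
    exact not_top_lt hlt
  have hlim : Tendsto (fun k : ℕ => κ *
      (ENNReal.ofReal (1 + 1 / ((k : ℝ) + 1)) * weightedEnergy A M v +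
        ENNReal.ofReal (C * ((1 / ((k : ℝ) + 1)) ^ 2 + 1 / ((k : ℝ) + 1))) * (c * J))) atTop
      (𝓝 (κ * weightedEnergy A M v)) := by
    have h1 : Tendsto (fun η : ℝ => κ * (ENNReal.ofReal (1 + η) * weightedEnergy A M v +
        ENNReal.ofReal (C * (η ^ 2 + η)) * (c * J))) (𝓝 0) (𝓝 (κ *
        (ENNReal.ofReal (1 + 0) * weightedEnergy A M v +
          ENNReal.ofReal (C * (0 ^ 2 + 0)) * (c * J)))) := by
      refine ENNReal.Tendsto.const_mul (Tendsto.add ?_ ?_) (Or.inr hκ)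
      · exact ENNReal.Tendsto.mul_const (ENNReal.tendsto_ofReal
          (Continuous.tendsto (by fun_prop) 0)) (Or.inr hNfin)
      · exact ENNReal.Tendsto.mul_const (ENNReal.tendsto_ofReal
          (Continuous.tendsto (by fun_prop) 0))
          (Or.inr (ENNReal.mul_ne_top ENNReal.coe_ne_top hJt))
    have h2 : κ * (ENNReal.ofReal (1 + 0) * weightedEnergy A M v +
        ENNReal.ofReal (C * (0 ^ 2 + 0)) * (c * J)) = κ * weightedEnergy A M v := by simp
    rw [h2] at h1
    exact h1.comp hη
  -- Only lower semicontinuity of the mass is needed, so Fatou suffices and the mass of `v` may be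
  -- infinite. Pointwise `w η → v`, since `χ = 1` near `0`.
  have hfatou : weightedMass A M v ≤
      liminf (fun k : ℕ => weightedMass A M (w (1 / ((k : ℝ) + 1)))) atTop := by
    refine le_trans (le_of_eq ?_) (lintegral_liminf_le fun k => ?_)
    · refine setLIntegral_congr_fun hΩm fun x hx => ?_
      have hP := partialNormSq_pos hm hx
      refine (Tendsto.liminf_eq ?_).symm
      refine ENNReal.tendsto_ofReal (Tendsto.div_const (Tendsto.const_mul _ (Tendsto.pow ?_ 2)) _)
      have h1 : Tendsto (fun η : ℝ => v x * χ (η ^ 2 * Real.log (partialNormSq m x))) (𝓝 0)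
          (𝓝 (v x * χ (0 ^ 2 * Real.log (partialNormSq m x)))) :=
        Continuous.tendsto (by have := hχs.continuous; fun_prop) 0
      have h2 := h1.comp hη
      have h3 : χ (0 ^ 2 * Real.log (partialNormSq m x)) = 1 := hχ1 _ (by norm_num)
      rw [h3, mul_one] at h2
      refine h2.congr fun k => ?_
      simp only [hw, Function.comp_apply, logProfile_of_pos _ hP]
    · have := (htrial (1 / ((k : ℝ) + 1)) Nat.one_div_pos_of_nat).contDiff.continuous.measurable
      fun_prop
  have hle := hfatou.trans (liminf_le_liminf (Eventually.of_forall hbound))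
  rw [hlim.liminf_eq] at hle
  exact absurd hlt (not_lt.2 hle)

end Cutoff

/-! ### Optimality of the constant -/

section Sharpness

variable {n : ℕ} [NeZero n]

/-- When `A M = 0`, the ground state representation has no spectral gap relative to `|X_M|⁻²`. -/
theorem exists_isTrial_one_weightedEnergy_lt {A : ℕ → ℝ} (hA : A 0 = 1) {M : ℕ} (hM : 1 ≤ M)
    (hMn : M ≤ n) (hA' : ∀ j, 1 ≤ j → j ≤ M → A j ≤ 0) (hAM : A M = 0) {κ : ℝ≥0∞} (hκ0 : κ ≠ 0)
    (hκ : κ ≠ ∞) :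
    ∃ v : EuclideanSpace ℝ (Fin n) → ℝ, IsTrial 1 v ∧
      κ * weightedEnergy A M v < weightedMass A M v := by
  -- Descend from `X_M = 0` to `X_1 = 0`, one cutoff for each stratum.
  have h : ∀ d, d < M → ∃ v : EuclideanSpace ℝ (Fin n) → ℝ, IsTrial (M - d) v ∧
      κ * weightedEnergy A M v < weightedMass A M v := by
    intro d
    induction d with
    | zero => exact fun _ => exists_isTrial_weightedEnergy_lt hA hM hMn hA' hAM hκ
    | succ d ih =>
      intro hd
      obtain ⟨v, hv, hlt⟩ := ih (by omega)
      rw [show M - d = M - (d + 1) + 1 by omega] at hv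
      exact hv.exists_cutoff hA (by omega) (by omega) hMn hA' hκ0 hκ hlt
  have := h (M - 1) (by omega)
  rwa [Nat.sub_sub_self hM] at this

lemma hardyIntegral_pos (u : 𝓓(upperHalfSpace n, ℝ)) (hu : u ≠ 0) {m : ℕ} (hm : 1 ≤ m) :
    0 < hardyIntegral m u := by
  have hus := u.tsupport_subset
  have hsub : tsupport (fun x => u x ^ 2) ⊆ tsupport u :=
    closure_mono fun x hx => by
      rw [Function.mem_support] at hx ⊢
      exact fun h => hx (by simp [h])
  rw [hardyIntegral, setIntegral_upperHalfSpace_eq hus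
    fun x hx => by simp [image_eq_zero_of_notMem_tsupport hx]]
  have hcont := continuous_mul_of_tsupport_subset (upperHalfSpace n).isOpen
    (u.continuous.pow 2) (hsub.trans hus)
    (continuousOn_div_partialNormSq continuous_const hm (f := fun _ => (1 : ℝ)))
  simp only [mul_one_div] at hcont
  obtain ⟨x, hx⟩ : ∃ x, u x ≠ 0 := by
    by_contra! h
    exact hu (TestFunction.ext h)
  refine hcont.integral_pos_of_hasCompactSupport_nonneg_nonzero
    (u.hasCompactSupport.mono fun y hy => ?_)
    (fun y => div_nonneg (sq_nonneg _) (partialNormSq_nonneg m y)) (x := x) ?_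
  · rw [Function.mem_support] at hy ⊢
    exact fun h => hy (by simp [h])
  · have := (partialNormSq_pos hm (hus (subset_tsupport _ hx))).ne'
    positivity

end Sharpness

theorem mainTheorem5 (n k : ℕ) [NeZero n] (hk : 1 ≤ k) (hkn : k ≤ n - 1)
    (α β : ℕ → ℝ)
    (hα : ∀ m : ℕ, 1 ≤ m → m ≤ k → α m ≤ 0)
    (hβ₁ : β 1 = -(α 1) ^ 2 + 1 / 4)
    (hβ : ∀ m : ℕ, 2 ≤ m → m ≤ k → β m = -(α m) ^ 2 + (α (m - 1) - 1 / 2) ^ 2) :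
    (∀ b : ℝ,
      (∀ u : 𝓓(upperHalfSpace n, ℝ),
        dirichletIntegral u ≥
          ∫ x in (upperHalfSpace n : Set (EuclideanSpace ℝ (Fin n))),
            ((∑ m ∈ Finset.Icc 1 k, β m / partialNormSq m x) + b / partialNormSq (k + 1) x)
              * u x ^ 2) →
      b ≤ (α k - 1 / 2) ^ 2) ∧
    IsGLB {q : ℝ | ∃ u : 𝓓(upperHalfSpace n, ℝ), u ≠ 0 ∧ q = hardyQuotient k β u}
      ((α k - 1 / 2) ^ 2) := by
  have hkn' : k + 1 ≤ n := by omega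
  -- `A 0 = 1` turns `1/4` into `(A 0 - 1/2)²`, so `β 1` fits the general formula. The value `A (k +
  -- 1) = 0` maximizes the last constant and makes the ground state critical.
  set A : ℕ → ℝ := fun j => if j = 0 then 1 else if j ≤ k then α j else 0 with hAdef
  have hA : A 0 = 1 := by simp [hAdef]
  have hAα : ∀ j, 1 ≤ j → j ≤ k → A j = α j := by
    intro j h1 h2
    simp [hAdef, h2, Nat.one_le_iff_ne_zero.1 h1]
  have hAM : A (k + 1) = 0 := by simp [hAdef]
  have hA' : ∀ j, 1 ≤ j → j ≤ k + 1 → A j ≤ 0 := by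
    intro j h1 h2
    rcases Nat.lt_or_ge k j with h | h
    · rw [show j = k + 1 by omega, hAM]
    · rw [hAα j h1 h]
      exact hα j h1 h
  have hconst : ∀ j ∈ Finset.Icc 1 k, hardyConst A j = β j := by
    intro j hj
    obtain ⟨h1, h2⟩ := Finset.mem_Icc.1 hj
    rcases h1.eq_or_lt with rfl | h
    · rw [hardyConst, hβ₁, hAα 1 le_rfl h2, Nat.sub_self, hA]
      norm_num
    · rw [hardyConst, hβ j h h2, hAα j h1 h2, hAα (j - 1) (by omega) (by omega)]
  have hconst' : hardyConst A (k + 1) = (α k - 1 / 2) ^ 2 := by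
    rw [hardyConst, hAM, Nat.add_sub_cancel, hAα k hk le_rfl]
    ring
  have hid : ∀ u : 𝓓(upperHalfSpace n, ℝ),
      dirichletIntegral u - ∑ m ∈ Finset.Icc 1 k, β m * hardyIntegral m u =
        (α k - 1 / 2) ^ 2 * hardyIntegral (k + 1) u +
          ∫ x in (upperHalfSpace n : Set (EuclideanSpace ℝ (Fin n))),
            ‖∇ u x - u x • groundField A (k + 1) x‖ ^ 2 := by
    intro u
    have h := dirichletIntegral_sub_sum_hardyIntegral (u.contDiff.of_le (by simp))
      u.hasCompactSupport u.tsupport_subset hA hkn'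
    rw [Finset.sum_Icc_succ_top (by omega), hconst',
      Finset.sum_congr rfl fun j hj => by rw [hconst j hj]] at h
    linarith
  have hglb : IsGLB {q : ℝ | ∃ u : 𝓓(upperHalfSpace n, ℝ), u ≠ 0 ∧ q = hardyQuotient k β u}
      ((α k - 1 / 2) ^ 2) := by
    constructor
    · rintro q ⟨u, hu, rfl⟩
      rw [hardyQuotient, le_div_iff₀ (hardyIntegral_pos u hu (by omega)), hid]
      exact le_add_of_nonneg_right (integral_nonneg fun x => by positivity)
    · intro b hb
      refine le_of_forall_pos_le_add fun ε hε => ?_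
      -- With `κ = 1/ε` the defect is less than `ε` times the Hardy integral, so the quotient is
      -- below `(α k - 1/2)² + ε`.
      obtain ⟨v, ⟨hvd, hvc, hvs⟩, hlt⟩ := exists_isTrial_one_weightedEnergy_lt hA
        (Nat.le_add_left 1 k) hkn' hA' hAM (κ := ENNReal.ofReal ε⁻¹)
        (ENNReal.ofReal_pos.2 (inv_pos.2 hε)).ne' ENNReal.ofReal_ne_top
      have hΩm := (upperHalfSpace n).isOpen.measurableSet
      set u := groundTest A (k + 1) v hvd hvc hvs with hu
      have hE : ∫ x in (upperHalfSpace n : Set (EuclideanSpace ℝ (Fin n))),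
          ‖∇ u x - u x • groundField A (k + 1) x‖ ^ 2 = (weightedEnergy A (k + 1) v).toReal := by
        rw [setIntegral_congr_fun hΩm fun x hx => norm_gradient_groundTest_sub hvd hvc hvs hx,
          weightedEnergy, integral_eq_lintegral_of_nonneg_ae]
        · exact ae_of_all _ fun x => mul_nonneg (groundWeight_nonneg _ _ _) (sq_nonneg _)
        · have := (continuous_gradient (hvd.of_le (m := 1) (by simp))).measurable
          exact (by fun_prop : Measurable fun x =>
            groundWeight A (k + 1) x * ‖∇ v x‖ ^ 2).aestronglyMeasurable
      have hH : ENNReal.ofReal (hardyIntegral (k + 1) u) = weightedMass A (k + 1) v := by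
        rw [hardyIntegral, ofReal_integral_eq_lintegral_ofReal, weightedMass]
        · refine setLIntegral_congr_fun hΩm fun x hx => ?_
          rw [hu, groundTest_apply hvd hvc hvs hx, mul_pow, groundState_sq]
        · exact (integrable_sq_div_partialNormSq u.continuous u.hasCompactSupport
            u.tsupport_subset (Nat.le_add_left 1 k)).integrableOn
        · exact ae_of_all _ fun x => div_nonneg (sq_nonneg _) (partialNormSq_nonneg _ x)
      have hNfin : weightedEnergy A (k + 1) v ≠ ∞ := by
        intro h
        rw [h, ENNReal.mul_top (ENNReal.ofReal_pos.2 (inv_pos.2 hε)).ne'] at hlt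
        exact not_top_lt hlt
      rw [← hH, ← ENNReal.ofReal_toReal hNfin, ← ENNReal.ofReal_mul (inv_pos.2 hε).le,
        ENNReal.ofReal_lt_ofReal_iff_of_nonneg (by positivity)] at hlt
      have hHpos : 0 < hardyIntegral (k + 1) u := lt_of_le_of_lt (by positivity) hlt
      have hu0 : u ≠ 0 := by
        intro h
        rw [h] at hHpos
        simp [hardyIntegral] at hHpos
      refine (hb ⟨u, hu0, rfl⟩).trans ?_
      rw [hardyQuotient, div_le_iff₀ hHpos, hid, hE, add_mul]
      rw [inv_mul_lt_iff₀ hε] at hlt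
      linarith
  -- Part (i) follows from (ii): the assumed inequality says precisely that `b` is a lower bound of
  -- the quotient.
  refine ⟨fun b hb => hglb.2 ?_, hglb⟩
  rintro q ⟨u, hu, rfl⟩
  have hint : ∀ j, 1 ≤ j → Integrable fun x => u x ^ 2 / partialNormSq j x := fun j hj =>
    integrable_sq_div_partialNormSq u.continuous u.hasCompactSupport u.tsupport_subset hj
  have hsplit : ∫ x in (upperHalfSpace n : Set (EuclideanSpace ℝ (Fin n))),
      ((∑ m ∈ Finset.Icc 1 k, β m / partialNormSq m x) + b / partialNormSq (k + 1) x) * u x ^ 2 =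
      ∑ m ∈ Finset.Icc 1 k, β m * hardyIntegral m u + b * hardyIntegral (k + 1) u := by
    have h1 : ∀ x, ((∑ m ∈ Finset.Icc 1 k, β m / partialNormSq m x) +
        b / partialNormSq (k + 1) x) * u x ^ 2 =
        (∑ m ∈ Finset.Icc 1 k, β m * (u x ^ 2 / partialNormSq m x)) +
          b * (u x ^ 2 / partialNormSq (k + 1) x) := by
      intro x
      rw [add_mul, Finset.sum_mul]
      congr 1
      · exact Finset.sum_congr rfl fun j _ => by ring
      · ring
    simp_rw [h1]
    rw [integral_add (integrable_finsetSum _ fun j hj =>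
        ((hint j (Finset.mem_Icc.1 hj).1).const_mul _).integrableOn)
        ((hint (k + 1) (by omega)).const_mul _).integrableOn,
      integral_finsetSum _ fun j hj =>
        ((hint j (Finset.mem_Icc.1 hj).1).const_mul _).integrableOn, integral_const_mul]
    simp_rw [integral_const_mul]
    rfl
  have h := hb u
  rw [hsplit] at h
  rw [hardyQuotient, le_div_iff₀ (hardyIntegral_pos u hu (by omega))]
  linarith
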